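/- An incidence geometry consists of a finite set $P$ of points and a finite collection $\mathcal B$ of subsets of $P$ (lines) such that any two distinct lines share at most one point. A configuration of type $(v_r,b_k)$, where $k\ge 3$, is an incidence geometry with $v$ points and $b$ lines in which every point lies on exactly $r$ lines and every line has exactly $k$ points; a configuration of type $(v_k)$ is one of type $(v_k,v_k)$. A configuration $(P,\mathcal B)$ is connected if it is not the disjoint union of two configurations $(P_1,\mathcal B_1)$, $(P_2,\mathcal B_2)$ with non-empty point sets (that is, $P=P_1\cup P_2$, $P_1\cap P_2=\emptyset$, $\mathcal B=\mathcal B_1\cup\mathcal B_2$). An isomorphism is a bijection between the point sets that maps the set of lines of the first geometry onto the set of lines of the second, and a configuration is cyclic if it has an automorphism that permutes its points in one full cycle. Let $\#C(v_3)$ denote the number of isomorphism classes of connected cyclic configurations of type $(v_3)$. Theorem A. Let $v>4$ be an integer with prime factorization $v=p_1^{n_1}\cdots p_k^{n_k}$ ($p_1,\dots,p_k$ distinct primes, $n_i\ge 1$). Then $$\#C(v_3)=\begin{cases}\dfrac v6\displaystyle\prod_{i=1}^k\Big(1+\frac1{p_i}\Big)+\alpha\,2^k-2 & \text{if } v \text{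 is odd},\\[2ex] \dfrac v6\displaystyle\prod_{i=1}^k\Big(1+\frac1{p_i}\Big)+\beta\,2^k-3 & \text{if } v \text{ is even},\end{cases}$$ where, for $v$ odd, $$\alpha=\begin{cases}5/6 & \text{if } p_i\equiv 1 \pmod 3 \text{ for every } i,\\ 2/3 & \text{if } 3 \mid v,\ 9\nmid v, \text{ and } p_i\equiv 1\pmod 3 \text{ for every } i \text{ with } p_i\neq 3,\\ 1/2 & \text{otherwise},\end{cases}$$ and, for $v$ even, $$\beta=\begin{cases}1/4 & \text{if } v\equiv 2 \text{ or } 6\pmod 8,\\ 1/2 & \text{if } v\equiv 4\pmod 8,\\ 1 & \text{if } v\equiv 0\pmod 8.\end{cases}$$ -/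

import Mathlib

/-- An incidence geometry whose points form a finite subset of `α`: a finite set of points and a
finite collection of lines (blocks), each of them a set of points, such that two distinct lines
share at most one point. -/
structure IncidenceGeometry (α : Type*) [DecidableEq α] where
  points : Finset α
  lines : Finset (Finset α)
  subset_points : ∀ B ∈ lines, B ⊆ points
  card_inter_le_one : ∀ B ∈ lines, ∀ B' ∈ lines, B ≠ B' → (B ∩ B').card ≤ 1

namespace IncidenceGeometry

variable {α : Type*} [DecidableEq α]

/-- `G` is a configuration of type `(v_r, b_k)`: it has `v` points and `b` lines, every point lies
on exactly `r` lines, and every line has exactly `k` points, where `k ≥ 3`. -/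
def IsConfiguration (G : IncidenceGeometry α) (v r b k : ℕ) : Prop :=
  G.points.card = v ∧ G.lines.card = b ∧ 3 ≤ k ∧
    (∀ p ∈ G.points, (G.lines.filter (fun B => p ∈ B)).card = r) ∧
    (∀ B ∈ G.lines, B.card = k)

/-- `G` is the disjoint union of two configurations (with non-empty point sets). -/
def IsDecomposable (G : IncidenceGeometry α) : Prop :=
  ∃ G₁ G₂ : IncidenceGeometry α,
    (∃ v r b k : ℕ, G₁.IsConfiguration v r b k) ∧
    (∃ v r b k : ℕ, G₂.IsConfiguration v r b k) ∧
    G₁.points.Nonempty ∧ G₂.points.Nonempty ∧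
    Disjoint G₁.points G₂.points ∧
    G.points = G₁.points ∪ G₂.points ∧
    G.lines = G₁.lines ∪ G₂.lines

/-- Connected means indecomposable. -/
def IsConnected (G : IncidenceGeometry α) : Prop := ¬ G.IsDecomposable

/-- `f` restricts to an isomorphism from `G` to `H`: a bijection from the points of `G` to the
points of `H` that maps the set of lines of `G` onto the set of lines of `H`. -/
def IsIsomorphism (G H : IncidenceGeometry α) (f : α → α) : Prop :=
  Set.BijOn f (G.points : Set α) (H.points : Set α) ∧
    G.lines.image (fun B => B.image f) = H.lines

/-- `G` and `H` are isomorphic. -/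
def Isomorphic (G H : IncidenceGeometry α) : Prop := ∃ f : α → α, IsIsomorphism G H f

/-- `G` is cyclic: some automorphism of `G` permutes its points in a full cycle. -/
def IsCyclic (G : IncidenceGeometry α) : Prop :=
  ∃ σ : Equiv.Perm α, IsIsomorphism G G σ ∧ σ.IsCycleOn (G.points : Set α)

theorem Isomorphic.refl (G : IncidenceGeometry α) : Isomorphic G G :=
  ⟨id, Set.bijOn_id _, by simp⟩

theorem Isomorphic.symm {G H : IncidenceGeometry α} (h : Isomorphic G H) : Isomorphic H G := by
  obtain ⟨f, hf, hl⟩ := h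
  obtain ⟨g, hg⟩ : ∃ g : α → α, Set.InvOn g f (G.points : Set α) (H.points : Set α) := by
    rcases isEmpty_or_nonempty α with he | hne
    · exact ⟨id, fun x => (he.false x).elim, fun x => (he.false x).elim⟩
    · exact ⟨_, hf.invOn_invFunOn⟩
  refine ⟨g, hf.symm hg.symm, ?_⟩
  rw [← hl, Finset.image_image]
  refine (Finset.image_congr (g := id) fun B hB => ?_).trans Finset.image_id
  have hB' : ∀ x ∈ B, g (f x) = x := fun x hx => hg.1 (G.subset_points B hB hx)
  simp only [Function.comp_apply, Finset.image_image, id]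
  exact (Finset.image_congr (g := id) fun x hx => hB' x hx).trans Finset.image_id

theorem Isomorphic.trans {G H K : IncidenceGeometry α} (h : Isomorphic G H)
    (h' : Isomorphic H K) : Isomorphic G K := by
  obtain ⟨f, hf, hl⟩ := h
  obtain ⟨g, hg, hl'⟩ := h'
  refine ⟨g ∘ f, hg.comp hf, ?_⟩
  rw [← hl', ← hl, Finset.image_image]
  congr 1
  funext B
  simp [Finset.image_image]

end IncidenceGeometry

/-- The connected cyclic configurations of type `(v_k)`, that is `(v_k, v_k)`, with points taken
from the `v`-element set `Fin v`. -/
def ConnectedCyclicConfiguration (v k : ℕ) : Type :=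
  {G : IncidenceGeometry (Fin v) // G.IsConfiguration v k v k ∧ G.IsConnected ∧ G.IsCyclic}

/-- Isomorphism of connected cyclic configurations of type `(v_k)`. -/
def isomorphismSetoid (v k : ℕ) : Setoid (ConnectedCyclicConfiguration v k) where
  r G H := IncidenceGeometry.Isomorphic G.1 H.1
  iseqv :=
    ⟨fun G => IncidenceGeometry.Isomorphic.refl G.1,
      fun h => IncidenceGeometry.Isomorphic.symm h,
      fun h h' => IncidenceGeometry.Isomorphic.trans h h'⟩

/-- `#C(v_k)`: the number of isomorphism classes of connected cyclic configurations of type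
`(v_k)`. -/
noncomputable def numConnectedCyclic (v k : ℕ) : ℕ :=
  Nat.card (Quotient (isomorphismSetoid v k))

/-- The coefficient `α` (for odd `v`). -/
def alphaCoeff (v : ℕ) : ℚ :=
  if ∀ p ∈ v.primeFactors, p % 3 = 1 then 5 / 6
  else if v.factorization 3 = 1 ∧ ∀ p ∈ v.primeFactors, p ≠ 3 → p % 3 = 1 then 2 / 3
  else 1 / 2

/-- The coefficient `β` (for even `v`). -/
def betaCoeff (v : ℕ) : ℚ :=
  if v % 8 = 2 ∨ v % 8 = 6 then 1 / 4
  else if v % 8 = 4 then 1 / 2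
  else 1

/-! A full cycle of automorphisms identifies the points with `ZMod v` so that the automorphism
becomes `x ↦ x + 1`. Some line then has `v` distinct translates, and these are all the lines, so the
configuration is the development of one base triple `s` (`exists_isDevelopment_of_isCyclic`).
Everything is read off the three side differences `d` of `s`, which sum to zero: two lines meet at
most once exactly when the six differences `± d i` are distinct, and connectedness means that the `d
i` generate the unit ideal.

The main point is rigidity: two such developments are isomorphic only if their base triples agree up
to `x ↦ u * x + w` and reordering (`affineEquivalent_of_incidence`). An isomorphism carries hexagons
of the incidence graph to hexagons; if it changed the position of points inside lines in a
non-uniform way, the closing-up equation of a hexagon would force a coincidence among the entries of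
`s`. The only coincidence that can really occur singles out the affine class of `{0, 1, -2}`, which
is treated separately.

Isomorphism classes are therefore the nondegenerate orbits of `(ZMod v)ˣ × S₃` on unimodular
zero-sum triples. Burnside's lemma counts all orbits (`card_orbit_mul`): the identity contributes
the pairs generating the unit ideal, transpositions the roots of `u ^ 2 = 1`, three-cycles the roots
of `u ^ 2 + u + 1 = 0`. All three counts are multiplicative and are evaluated at prime powers
(`natCard_orbit`). Finally the degenerate orbits are removed: those of `(0, 1, -1)` and `(1, 1,
-2)`, and for even `v` also that of `(v/2, 1, -1 - v/2)`, which accounts for the `-2` and the `-3`.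
-/

namespace CyclicConfiguration

open Finset

/-! ### Rigidity of incidence isomorphisms via hexagons -/

section Rigidity

variable {A B : Type*} [AddCommGroup A] [AddCommGroup B]

/-- The six differences of distinct members of a triple are pairwise distinct. -/
def Sidon (s : Fin 3 → A) : Prop :=
  ∀ i j k l, i ≠ j → s i - s j = s k - s l → i = k ∧ j = l

theorem Sidon.injective {s : Fin 3 → A} (hs : Sidon s) : Function.Injective s := by
  intro i j h
  by_contra hij
  have := hs i j j i hij (by rw [h])
  exact hij this.1

/-- This is how generation by differences is exploited throughout: for constancy of labels, for
additivity of isomorphisms and for connectedness. -/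
theorem eq_of_invariant_of_closure_eq_top {C : Type*} {D : Set A}
    (hD : AddSubgroup.closure D = ⊤) {h : A → C} (hh : ∀ d ∈ D, ∀ i, h (i + d) = h i) (i j : A) :
    h i = h j := by
  have key : ∀ x ∈ AddSubgroup.closure D, ∀ i, h (i + x) = h i := by
    intro x hx
    induction hx using AddSubgroup.closure_induction with
    | mem x hx => exact hh x hx
    | zero => simp
    | add x y _ _ hx hy => intro i; rw [← add_assoc, hy, hx]
    | neg x _ hx => intro i; rw [← hx (i + -x)]; simp
  have := key (j - i) (hD ▸ AddSubgroup.mem_top _) i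
  rw [← this]; simp

-- The possible shapes of a pulled-back hexagon: `j, k` are its two known positions and `u, w, w'`
-- the unknown ones, subject to consecutive edges being different.
set_option synthInstance.maxSize 1000 in
set_option synthInstance.maxHeartbeats 200000 in
theorem fin_three_cases : ∀ j k u w w' : Fin 3, j ≠ k → u ≠ k → w ≠ u → w' ≠ w → w' ≠ k →
    (w = k ∧ u = j ∧ w' = j) ∨ (w = k ∧ u = w' ∧ u ≠ j) ∨
    (w = k ∧ u = j ∧ w' ≠ j) ∨ (w = k ∧ w' = j ∧ u ≠ j) ∨
    (w ≠ k ∧ u = w' ∧ j = w) ∨ (w ≠ k ∧ u = w' ∧ j = u) := by decide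

theorem fin_three_eq_of_ne : ∀ a b x y : Fin 3, x ≠ y → a ≠ x → a ≠ y → b ≠ x → b ≠ y → a = b := by
  decide

theorem fin_three_exists_third : ∀ j k : Fin 3, j ≠ k → ∃ z, z ≠ j ∧ z ≠ k ∧
    ∀ i, i = j ∨ i = k ∨ i = z := by
  decide

variable {s : Fin 3 → A} {t : Fin 3 → B} {f g : A ≃ B} {l : A → Fin 3 → Fin 3}

theorem label_ne_of_index_ne (hs : Sidon s) (hl : ∀ i k, f (i + s k) = g i + t (l i k))
    {i : A} {j k : Fin 3} (hjk : j ≠ k) : l i j ≠ l i k := by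
  intro h
  have : f (i + s j) = f (i + s k) := by rw [hl, hl, h]
  exact hjk (hs.injective (add_left_cancel (f.injective this)))

theorem label_ne_of_line_ne (hl : ∀ i k, f (i + s k) = g i + t (l i k))
    {i i' : A} {j k : Fin 3} (hi : i ≠ i') (h : i + s j = i' + s k) : l i j ≠ l i' k := by
  intro h'
  have : g i + t (l i j) = g i' + t (l i' k) := by rw [← hl, ← hl, h]
  rw [h'] at this
  exact hi (g.injective (add_right_cancel this))

/-- Opposite edges of a hexagon of the incidence graph keep equal labels under an isomorphism. -/
theorem label_eq_of_not_three_torsion (hs : Sidon s) (ht : Function.Injective t)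
    (hrel : ∀ i j k, i ≠ j → j ≠ k → i ≠ k → 3 • s i ≠ 2 • s j + s k)
    (hfg : ∀ p i, (∃ k, p = i + s k) ↔ ∃ k, f p = g i + t k)
    (hl : ∀ i k, f (i + s k) = g i + t (l i k))
    (i : A) {j k : Fin 3} (hjk : j ≠ k) (h3 : 3 • s j ≠ 3 • s k) :
    l i k = l (i + s k - s j) k := by
  by_contra hne
  set i' := i + s k - s j with hi'
  have hii' : i ≠ i' := by
    intro h
    have : s k = s j := by
      have h2 : i + s k = i + s j := by nth_rewrite 2 [h]; rw [hi']; abel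
      exact add_left_cancel h2
    exact hjk (hs.injective this.symm)
  have hp : i + s k = i' + s j := by rw [hi']; abel
  have e1 : g i + t (l i k) = g i' + t (l i' j) := by rw [← hl, ← hl, hp]
  have n1 : l i k ≠ l i' j := label_ne_of_line_ne hl hii' hp
  have n2 : l i' j ≠ l i' k := label_ne_of_index_ne hs hl hjk
  -- The labels `l i k`, `l i' j`, `l i' k` are now pairwise distinct. The image lines `g i` and `g
  -- i'` meet, and a third line `g n` closes them up to a hexagon with the points `f q` and `f (i' +
  -- s k)`. Pulling it back gives the unknown positions `u`, `w`, `w'`.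
  obtain ⟨q, hq⟩ := f.surjective (g i + t (l i' k))
  obtain ⟨n, hn⟩ := g.surjective (g i' + t (l i' k) - t (l i k))
  obtain ⟨u, hu⟩ := (hfg q i).2 ⟨_, hq⟩
  obtain ⟨w, hw⟩ := (hfg q n).2 ⟨l i' j, by
    rw [hq, hn, sub_add_eq_add_sub, eq_sub_iff_add_eq]
    calc _ = (g i + t (l i k)) + t (l i' k) := by abel
      _ = _ := by rw [e1]; abel⟩
  obtain ⟨w', hw'⟩ := (hfg (i' + s k) n).2 ⟨l i k, by rw [hl, hn]; abel⟩
  have c1 : u ≠ k := by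
    rintro rfl
    rw [hu, hl] at hq
    exact hne (ht (add_left_cancel hq))
  have c2 : w ≠ u := by
    rintro rfl
    have : i = n := add_right_cancel (hu.symm.trans hw)
    rw [← this] at hn
    rw [hn] at e1
    apply n2
    apply ht
    have : g i' + t (l i' k) = g i' + t (l i' j) := by rw [← e1]; abel
    exact (add_left_cancel this).symm
  have c3 : w' ≠ w := by
    rintro rfl
    rw [← hw] at hw'
    rw [← hw', hl] at hq
    exact hii' (g.injective (add_right_cancel hq).symm)
  have c4 : w' ≠ k := by
    rintro rfl
    rw [← add_right_cancel hw'] at hn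
    apply hne
    apply ht
    have : g i' + t (l i w') = g i' + t (l i' w') := by nth_rewrite 1 [hn]; abel
    exact add_left_cancel this
  -- The steps `i → i' → n → i` around the pulled-back hexagon sum to zero.
  have key : s u + s w' + s j = s w + 2 • s k := by
    have e2 : i + s u = n + s w := hu.symm.trans hw
    have e3 : s u = n + s w - i := by rw [← e2]; abel
    have e4 : s w' = i' + s k - n := by rw [hw']; abel
    rw [e3, e4, hi']; abel
  -- In the first case `key` contradicts `h3`, in the fifth the Sidon property, and in the other
  -- four it is an instance of the relation excluded by `hrel`.
  rcases fin_three_cases j k u w w' hjk c1 c2 c3 c4 with ⟨rfl, rfl, rfl⟩ | ⟨rfl, rfl, h⟩ |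
    ⟨rfl, rfl, h⟩ | ⟨rfl, rfl, h⟩ | ⟨h, rfl, rfl⟩ | ⟨h, rfl, rfl⟩
  · apply h3
    calc 3 • s w' = s w' + s w' + s w' := by abel
      _ = _ := by rw [key]; abel
  · apply hrel w u j c2 h hjk.symm
    calc 3 • s w = s w + 2 • s w := by abel
      _ = _ := by rw [← key]; abel
  · apply hrel w u w' c2 h.symm c3.symm
    calc 3 • s w = s w + 2 • s w := by abel
      _ = _ := by rw [← key]; abel
  · apply hrel w w' u c3.symm h.symm c2
    calc 3 • s w = s w + 2 • s w := by abel
      _ = _ := by rw [← key]; abel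
  · refine c4 (hs u k k u c4 ?_).1
    have : s u + s u = 2 • s k := by
      apply add_right_cancel (b := s j)
      rw [key]; abel
    rw [sub_eq_sub_iff_add_eq_add, this]; abel
  · apply hrel j k w c1 h.symm c2.symm
    calc 3 • s j = s j + s j + s j := by abel
      _ = _ := by rw [key]; abel

/-- It suffices to move along generators `s k - s j`. If `3 • s j = 3 • s k`, the hexagon argument
is unavailable for this pair, but it works for the third position `z` against both, and the label at
`k` is then recovered by elimination. -/
theorem label_eq_label (hs : Sidon s) (ht : Function.Injective t)
    (hgen : ∀ k, AddSubgroup.closure (Set.range fun j => s k - s j) = ⊤)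
    (hA : ∃ a : A, 3 • a ≠ 0)
    (hrel : ∀ i j k, i ≠ j → j ≠ k → i ≠ k → 3 • s i ≠ 2 • s j + s k)
    (hfg : ∀ p i, (∃ k, p = i + s k) ↔ ∃ k, f p = g i + t k)
    (hl : ∀ i k, f (i + s k) = g i + t (l i k))
    (k : Fin 3) (i i' : A) : l i k = l i' k := by
  refine eq_of_invariant_of_closure_eq_top (hgen k) (h := fun i => l i k) ?_ i i'
  rintro _ ⟨j, rfl⟩ i
  change l (i + (s k - s j)) k = l i k
  rw [← add_sub_assoc]
  by_cases hjk : j = k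
  · subst hjk; simp
  by_cases h3 : 3 • s j ≠ 3 • s k
  · exact (label_eq_of_not_three_torsion hs ht hrel hfg hl i hjk h3).symm
  push Not at h3
  obtain ⟨z, hzj, hzk, hz⟩ := fin_three_exists_third j k hjk
  -- Otherwise all generating differences, hence all of `A`, would be killed by 3.
  have h3z : 3 • s j ≠ 3 • s z := by
    intro h
    obtain ⟨a, ha⟩ := hA
    apply ha
    have : a ∈ AddSubgroup.closure (Set.range fun j => s z - s j) := by
      rw [hgen z]; trivial
    clear ha
    induction this using AddSubgroup.closure_induction with
    | mem x hx =>
      obtain ⟨i, rfl⟩ := hx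
      dsimp only
      rw [smul_sub]
      rcases hz i with rfl | rfl | rfl
      · rw [h, sub_self]
      · rw [← h3, h, sub_self]
      · rw [sub_self]
    | zero => simp
    | add x y _ _ hx hy => rw [smul_add, hx, hy, add_zero]
    | neg x _ hx => rw [smul_neg, hx, neg_zero]
  have hconst : ∀ i i', l i z = l i' z := by
    refine eq_of_invariant_of_closure_eq_top (hgen z) (h := fun i => l i z) ?_
    rintro _ ⟨m, rfl⟩ i
    change l (i + (s z - s m)) z = l i z
    rw [← add_sub_assoc]
    rcases hz m with rfl | rfl | rfl
    · exact (label_eq_of_not_three_torsion hs ht hrel hfg hl i hzj.symm h3z).symm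
    · exact (label_eq_of_not_three_torsion hs ht hrel hfg hl i hzk.symm (h3 ▸ h3z)).symm
    · simp
  have hii' : i ≠ i + s k - s j := by
    intro h
    apply hjk
    apply hs.injective
    have : i + s j = i + s k := by nth_rewrite 1 [h]; abel
    exact add_left_cancel this
  -- Both labels at `k` avoid the same two values: the constant label at `z`, and the label of
  -- position `j` on the shifted line, whose point there is the point at `k` on line `i`.
  refine fin_three_eq_of_ne _ _ (l (i + s k - s j) j) (l i z) ?_ ?_ ?_ ?_ ?_
  · rw [hconst i (i + s k - s j)]
    exact label_ne_of_index_ne hs hl hzj.symm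
  · exact label_ne_of_index_ne hs hl (Ne.symm hjk)
  · rw [hconst i (i + s k - s j)]
    exact label_ne_of_index_ne hs hl hzk.symm
  · exact label_ne_of_line_ne hl hii' (by abel)
  · exact label_ne_of_index_ne hs hl hzk.symm

/-- An isomorphism between the structures with lines `i + s` and `i + t` translates labels
uniformly. -/
theorem exists_perm_label (hs : Sidon s) (ht : Function.Injective t)
    (hgen : ∀ k, AddSubgroup.closure (Set.range fun j => s k - s j) = ⊤)
    (hA : ∃ a : A, 3 • a ≠ 0)
    (hrel : ∀ i j k, i ≠ j → j ≠ k → i ≠ k → 3 • s i ≠ 2 • s j + s k)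
    (hfg : ∀ p i, (∃ k, p = i + s k) ↔ ∃ k, f p = g i + t k) :
    ∃ σ : Equiv.Perm (Fin 3), ∀ i k, f (i + s k) = g i + t (σ k) := by
  choose l hl using fun i k => (hfg (i + s k) i).1 ⟨k, rfl⟩
  have hinj : Function.Injective (l 0) := by
    intro j k h
    by_contra hjk
    exact label_ne_of_index_ne hs hl hjk h
  refine ⟨Equiv.ofBijective _ (Finite.injective_iff_bijective.1 hinj), fun i k => ?_⟩
  rw [hl, label_eq_label hs ht hgen hA hrel hfg hl k i 0]
  rfl

end Rigidity

/-! ### Base triples in `ZMod v`, their differences and affine equivalence -/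

section Triples

variable {v : ℕ}

/-- The side differences of a triple; the `i`-th one omits `s i`. -/
def diffs (s : Fin 3 → ZMod v) : Fin 3 → ZMod v := fun i => s (i + 1) - s (i + 2)

/-- The entries of `d` generate the unit ideal. -/
def Unimodular (d : Fin 3 → ZMod v) : Prop := ∃ a : Fin 3 → ZMod v, ∑ i, a i * d i = 1

/-- The differences `± d i` of the sides of a triangle are pairwise distinct. -/
def Nondegenerate (d : Fin 3 → ZMod v) : Prop :=
  (∀ i j, i ≠ j → d i ≠ d j) ∧ ∀ i, 2 * d i ≠ 0

theorem sum_diffs (s : Fin 3 → ZMod v) : ∑ i, diffs s i = 0 := by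
  simp [Fin.sum_univ_three, diffs]
  ring

theorem exists_diffs_eq {d : Fin 3 → ZMod v} (hd : ∑ i, d i = 0) : ∃ s, diffs s = d := by
  refine ⟨![0, -d 2, d 1], ?_⟩
  rw [Fin.sum_univ_three] at hd
  funext i
  fin_cases i
  · simp [diffs]; linear_combination -hd
  · simp [diffs]
  · simp [diffs]

theorem fin_three_side : ∀ i j : Fin 3, i ≠ j →
    ∃ m, (i = m + 1 ∧ j = m + 2) ∨ (i = m + 2 ∧ j = m + 1) := by decide

theorem sum_fin_three {M : Type*} [AddCommMonoid M] (d : Fin 3 → M) {i j k : Fin 3}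
    (hij : i ≠ j) (hik : i ≠ k) (hjk : j ≠ k) : ∑ m, d m = d i + d j + d k := by
  have : (univ : Finset (Fin 3)) = {i, j, k} := by
    revert i j k; decide
  rw [this, sum_insert (by simp [hij, hik]), sum_insert (by simp [hjk]), sum_singleton, add_assoc]

/-- The six differences are `± d i`. A coincidence `d m = -d n` with `m ≠ n` need not be excluded
separately: as the sides sum to zero, it makes the third side vanish. -/
theorem sidon_iff_nondegenerate {s : Fin 3 → ZMod v} : Sidon s ↔ Nondegenerate (diffs s) := by
  constructor
  · intro hs
    refine ⟨fun i j hij h => hij ?_, fun i h => ?_⟩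
    · exact add_right_cancel (hs (i + 1) (i + 2) (j + 1) (j + 2) (by clear * -; revert i; decide) h).1
    · have := (hs (i + 1) (i + 2) (i + 2) (i + 1) (by clear h; revert i; decide)
        (by unfold diffs at h; linear_combination h)).1
      clear h; revert i; decide
  · rintro ⟨h1, h2⟩ i j k l hij h
    have h0 : ∀ m, diffs s m ≠ 0 := fun m hm => h2 m (by rw [hm, mul_zero])
    have hopp : ∀ m n, diffs s m ≠ -diffs s n := by
      intro m n hmn
      by_cases hmn' : m = n
      · subst hmn'; exact h2 m (by linear_combination hmn)
      · obtain ⟨z, hzm, hzn, -⟩ := fin_three_exists_third m n hmn'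
        apply h0 z
        have := sum_diffs s
        rw [sum_fin_three _ hmn' hzm.symm hzn.symm] at this
        linear_combination this - hmn
    have hkl : k ≠ l := by
      rintro rfl
      obtain ⟨m, ⟨rfl, rfl⟩ | ⟨rfl, rfl⟩⟩ := fin_three_side i j hij
      · exact h0 m (by unfold diffs; linear_combination h)
      · exact h0 m (by unfold diffs; linear_combination -h)
    obtain ⟨m, ⟨rfl, rfl⟩ | ⟨rfl, rfl⟩⟩ := fin_three_side i j hij <;>
    obtain ⟨n, ⟨rfl, rfl⟩ | ⟨rfl, rfl⟩⟩ := fin_three_side k l hkl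
    · have : m = n := by
        by_contra hmn; exact h1 m n hmn h
      simp [this]
    · exact absurd (by unfold diffs; linear_combination h) (hopp m n)
    · exact absurd (by unfold diffs; linear_combination -h) (hopp m n)
    · have : m = n := by
        by_contra hmn; exact h1 m n hmn (by unfold diffs; linear_combination -h)
      simp [this]

/-- `t` is, up to the order of its entries, the image of `s` under an affine bijection. -/
def AffineEquivalent (s t : Fin 3 → ZMod v) : Prop :=
  ∃ (u : (ZMod v)ˣ) (σ : Equiv.Perm (Fin 3)) (w : ZMod v), ∀ k, t (σ k) = u * s k + w

theorem AffineEquivalent.symm {s t : Fin 3 → ZMod v} (h : AffineEquivalent s t) :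
    AffineEquivalent t s := by
  obtain ⟨u, σ, w, h⟩ := h
  refine ⟨u⁻¹, σ⁻¹, -(↑u⁻¹ * w), fun k => ?_⟩
  have := h (σ⁻¹ k)
  rw [show σ (σ⁻¹ k) = k by simp] at this
  rw [this]
  linear_combination (-s (σ⁻¹ k)) * u.inv_mul

theorem AffineEquivalent.trans {s t r : Fin 3 → ZMod v} (h : AffineEquivalent s t)
    (h' : AffineEquivalent t r) : AffineEquivalent s r := by
  obtain ⟨u, σ, w, h⟩ := h
  obtain ⟨u', σ', w', h'⟩ := h'
  refine ⟨u' * u, σ' * σ, u' * w + w', fun k => ?_⟩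
  rw [Equiv.Perm.mul_apply, h', h, Units.val_mul]
  ring

theorem perm_fin_three_rotation_or_reflection : ∀ σ : Equiv.Perm (Fin 3),
    (∀ i, σ (i + 1) = σ i + 1 ∧ σ (i + 2) = σ i + 2) ∨
    (∀ i, σ (i + 1) = σ i + 2 ∧ σ (i + 2) = σ i + 1) := by decide

/-- Differences forget the translation. An odd reordering of the vertices reverses the orientation
of the sides, which is absorbed by replacing `u` with `-u`. -/
theorem affineEquivalent_iff_diffs {s t : Fin 3 → ZMod v} : AffineEquivalent s t ↔
    ∃ (u : (ZMod v)ˣ) (σ : Equiv.Perm (Fin 3)), ∀ k, diffs t (σ k) = u * diffs s k := by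
  constructor
  · rintro ⟨u, σ, w, h⟩
    rcases perm_fin_three_rotation_or_reflection σ with hσ | hσ
    · refine ⟨u, σ, fun k => ?_⟩
      unfold diffs
      rw [← (hσ k).1, ← (hσ k).2, h, h]; ring
    · refine ⟨-u, σ, fun k => ?_⟩
      unfold diffs
      rw [← (hσ k).1, ← (hσ k).2, h, h, Units.val_neg]; ring
  · rintro ⟨u, σ, h⟩
    have main : ∃ e : (ZMod v)ˣ, ∀ k, t (σ (k + 1)) - t (σ (k + 2)) = e * (s (k + 1) - s (k + 2)) := by
      rcases perm_fin_three_rotation_or_reflection σ with hσ | hσ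
      · refine ⟨u, fun k => ?_⟩
        rw [(hσ k).1, (hσ k).2]; exact h k
      · refine ⟨-u, fun k => ?_⟩
        rw [(hσ k).1, (hσ k).2, Units.val_neg]
        have := h k
        unfold diffs at this
        linear_combination -this
    obtain ⟨e, he⟩ := main
    refine ⟨e, σ, t (σ 0) - e * s 0, fun k => ?_⟩
    have h1 := he 1
    have h2 := he 2
    simp only [Fin.isValue, show (1 : Fin 3) + 1 = 2 from rfl, show (1 : Fin 3) + 2 = 0 from rfl,
      show (2 : Fin 3) + 1 = 0 from rfl, show (2 : Fin 3) + 2 = 1 from rfl] at h1 h2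
    fin_cases k
    · simp
    · simp; linear_combination -h2
    · simp; linear_combination h1

theorem Unimodular.isUnit_of_dvd {d : Fin 3 → ZMod v} (hd : Unimodular d) {x : ZMod v}
    (h : ∀ i, x ∣ d i) : IsUnit x := by
  obtain ⟨a, ha⟩ := hd
  exact isUnit_of_dvd_one (ha ▸ dvd_sum fun i _ => (h i).mul_left _)

theorem perm_fin_three_exists : ∀ i j k : Fin 3, i ≠ j → j ≠ k → i ≠ k →
    ∃ σ : Equiv.Perm (Fin 3), σ i = 0 ∧ σ j = 1 ∧ σ k = 2 := by decide

theorem sub_mem_closure {s : Fin 3 → ZMod v} (k i j : Fin 3) :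
    s i - s j ∈ AddSubgroup.closure (Set.range fun j => s k - s j) := by
  have h := fun j => AddSubgroup.subset_closure (Set.mem_range_self (f := fun j => s k - s j) j)
  have := AddSubgroup.sub_mem _ (h j) (h i)
  simpa using this

/-- A triple satisfying the exceptional relation is a copy of `{0, 1, -2}`. -/
theorem affineEquivalent_of_relation {s : Fin 3 → ZMod v} (hs : Unimodular (diffs s))
    {i j k : Fin 3} (hij : i ≠ j) (hjk : j ≠ k) (hik : i ≠ k) (h : 3 • s i = 2 • s j + s k) :
    AffineEquivalent ![0, 1, -2] s := by
  obtain ⟨σ, h0, h1, h2⟩ := perm_fin_three_exists i j k hij hjk hik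
  have hk : s k = s i - 2 * (s j - s i) := by
    simp only [nsmul_eq_mul, Nat.cast_ofNat] at h
    linear_combination -h
  have hx : ∀ m, s j - s i ∣ s m - s i := by
    intro m
    have : m = i ∨ m = j ∨ m = k := by clear * - hij hjk hik; revert m i j k; decide
    rcases this with rfl | rfl | rfl
    · simp
    · simp
    · exact ⟨-2, by rw [hk]; ring⟩
  obtain ⟨u, hu⟩ := hs.isUnit_of_dvd (x := s j - s i) fun m => by
    have := dvd_sub (hx (m + 1)) (hx (m + 2))
    rwa [sub_sub_sub_cancel_right] at this
  refine ⟨u, σ⁻¹, s i, fun m => ?_⟩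
  have e0 : σ⁻¹ 0 = i := by rw [← h0]; simp
  have e1 : σ⁻¹ 1 = j := by rw [← h1]; simp
  have e2 : σ⁻¹ 2 = k := by rw [← h2]; simp
  fin_cases m
  · simp [e0]
  · simp [e1, hu]
  · simp only [Fin.reduceFinMk, e2, hk, hu]; simp; ring

variable [NeZero v]

theorem mul_mem_addSubgroup (H : AddSubgroup (ZMod v)) {x : ZMod v} (hx : x ∈ H) (a : ZMod v) :
    a * x ∈ H := by
  have := H.nsmul_mem hx a.val
  rwa [nsmul_eq_mul, ZMod.natCast_zmod_val] at this

theorem Unimodular.closure_eq_top {s : Fin 3 → ZMod v} (hs : Unimodular (diffs s)) (k : Fin 3) :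
    AddSubgroup.closure (Set.range fun j => s k - s j) = ⊤ := by
  obtain ⟨a, ha⟩ := hs
  rw [AddSubgroup.eq_top_iff']
  intro x
  rw [← mul_one x, ← ha]
  exact mul_mem_addSubgroup _ (AddSubgroup.sum_mem _ fun i _ =>
    mul_mem_addSubgroup _ (sub_mem_closure k _ _) _) _

/-- Uniform labels make `f (i + x) - f i` independent of `i`, first for generating differences and
so for all shifts. Thus `f - f 0` is additive, that is, multiplication by a constant, and
surjectivity makes this constant a unit. -/
theorem affine_of_perm_label {s t : Fin 3 → ZMod v} (hs : Unimodular (diffs s))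
    {f g : ZMod v ≃ ZMod v} {σ : Equiv.Perm (Fin 3)}
    (h : ∀ i k, f (i + s k) = g i + t (σ k)) : AffineEquivalent s t := by
  have hstep : ∀ i j k, f (i + (s k - s j)) = f i + (t (σ k) - t (σ j)) := by
    intro i j k
    have h1 := h (i - s j) k
    have h2 := h (i - s j) j
    rw [sub_add_cancel] at h2
    rw [h2, show i + (s k - s j) = i - s j + s k by ring, h1]; ring
  have hadd : ∀ i x, f (i + x) - f i = f (0 + x) - f 0 := by
    intro i x
    refine eq_of_invariant_of_closure_eq_top (hs.closure_eq_top 0)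
      (h := fun i => f (i + x) - f i) ?_ i 0
    rintro _ ⟨j, rfl⟩ i
    dsimp only
    rw [hstep, add_right_comm, hstep]; ring
  let F : ZMod v →+ ZMod v :=
    { toFun := fun x => f x - f 0
      map_zero' := by simp
      map_add' := fun x y => by
        have := hadd x y
        rw [zero_add] at this
        rw [← this]; ring }
  have hF : ∀ x, F x = F 1 * x := by
    intro x
    have := F.map_nsmul x.val 1
    rwa [nsmul_eq_mul, mul_one, ZMod.natCast_zmod_val, nsmul_eq_mul, ZMod.natCast_zmod_val,
      mul_comm] at this
  have hunit : IsUnit (F 1) := by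
    obtain ⟨x, hx⟩ := f.surjective (1 + f 0)
    have : F 1 * x = 1 := by rw [← hF]; change f x - f 0 = 1; rw [hx]; ring
    exact IsUnit.of_mul_eq_one _ this
  obtain ⟨u, hu⟩ := hunit
  refine ⟨u, σ, t (σ 0) - u * s 0, fun k => ?_⟩
  have h1 := hstep 0 0 k
  have h2 := hF (s k - s 0)
  rw [zero_add] at h1
  change f (s k - s 0) - f 0 = _ at h2
  rw [hu]
  linear_combination h2 - h1

/-- A Bays–Lambossy type rigidity theorem for cyclic triple structures. -/
theorem affineEquivalent_of_incidence (hv : 4 < v) {s t : Fin 3 → ZMod v} (hs : Sidon s)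
    (hs' : Unimodular (diffs s)) (ht : Sidon t) (ht' : Unimodular (diffs t)) {f g : ZMod v ≃ ZMod v}
    (hfg : ∀ p i, (∃ k, p = i + s k) ↔ ∃ k, f p = g i + t k) : AffineEquivalent s t := by
  have hA : ∃ a : ZMod v, 3 • a ≠ 0 := by
    refine ⟨1, ?_⟩
    rw [nsmul_eq_mul, mul_one, Ne, ZMod.natCast_eq_zero_iff]
    exact Nat.not_dvd_of_pos_of_lt (by norm_num) (by omega)
  by_cases hrs : ∀ i j k, i ≠ j → j ≠ k → i ≠ k → 3 • s i ≠ 2 • s j + s k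
  · obtain ⟨σ, hσ⟩ := exists_perm_label hs ht.injective hs'.closure_eq_top hA hrs hfg
    exact affine_of_perm_label hs' hσ
  by_cases hrt : ∀ i j k, i ≠ j → j ≠ k → i ≠ k → 3 • t i ≠ 2 • t j + t k
  · obtain ⟨σ, hσ⟩ := exists_perm_label (f := f.symm) (g := g.symm) ht hs.injective
      ht'.closure_eq_top hA hrt fun p i => by
        have := hfg (f.symm p) (g.symm i)
        rw [f.apply_symm_apply, g.apply_symm_apply] at this
        exact this.symm
    exact (affine_of_perm_label ht' hσ).symm
  -- Rigidity is symmetric, so it is enough that one triple avoids the exceptional relation. If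
  -- neither does, both are copies of `{0, 1, -2}`.
  push Not at hrs hrt
  obtain ⟨i, j, k, h1, h2, h3, h⟩ := hrs
  obtain ⟨i', j', k', h1', h2', h3', h'⟩ := hrt
  exact (affineEquivalent_of_relation hs' h1 h2 h3 h).symm.trans
    (affineEquivalent_of_relation ht' h1' h2' h3' h')

end Triples

end CyclicConfiguration

/-! ### Splitting a configuration along a union of lines -/

namespace IncidenceGeometry

open Finset

variable {α : Type*} [DecidableEq α]

/-- The geometry formed by the points in `Q` and the lines inside `Q`. -/
def restrict (G : IncidenceGeometry α) (Q : Finset α) : IncidenceGeometry α where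
  points := Q
  lines := G.lines.filter (· ⊆ Q)
  subset_points _ hB := (mem_filter.1 hB).2
  card_inter_le_one _ hB _ hB' := G.card_inter_le_one _ (mem_filter.1 hB).1 _ (mem_filter.1 hB').1

theorem IsConfiguration.restrict {G : IncidenceGeometry α} {v r b k : ℕ}
    (hG : G.IsConfiguration v r b k) {Q : Finset α} (hQ : Q ⊆ G.points)
    (h : ∀ B ∈ G.lines, B ⊆ Q ∨ Disjoint B Q) :
    ∃ v r b k, (G.restrict Q).IsConfiguration v r b k := by
  obtain ⟨-, -, hk, hr, hB⟩ := hG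
  refine ⟨Q.card, r, (G.lines.filter (· ⊆ Q)).card, k, rfl, rfl, hk, fun p hp => ?_,
    fun B h => hB B (mem_filter.1 h).1⟩
  rw [← hr p (hQ hp)]
  congr 1
  ext B
  simp only [IncidenceGeometry.restrict, mem_filter]
  refine ⟨fun hB => ⟨hB.1.1, hB.2⟩, fun hB => ⟨⟨hB.1, ?_⟩, hB.2⟩⟩
  exact (h B hB.1).resolve_right fun hd => disjoint_left.1 hd hB.2 hp

theorem IsConfiguration.isDecomposable {G : IncidenceGeometry α} {v r b k : ℕ}
    (hG : G.IsConfiguration v r b k) {Q : Finset α} (hQ : Q ⊆ G.points) (hne : Q.Nonempty)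
    (hne' : (G.points \ Q).Nonempty) (h : ∀ B ∈ G.lines, B ⊆ Q ∨ Disjoint B Q) :
    G.IsDecomposable := by
  have h' : ∀ B ∈ G.lines, Disjoint B Q → B ⊆ G.points \ Q := fun B hB hd x hx =>
    mem_sdiff.2 ⟨G.subset_points B hB hx, disjoint_left.1 hd hx⟩
  refine ⟨G.restrict Q, G.restrict (G.points \ Q), hG.restrict hQ h,
    hG.restrict sdiff_subset fun B hB => ?_, hne, hne', disjoint_sdiff,
    (union_sdiff_of_subset hQ).symm, ?_⟩
  · rcases h B hB with hs | hd
    · exact Or.inr (disjoint_of_subset_left hs disjoint_sdiff)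
    · exact Or.inl (h' B hB hd)
  · ext B
    simp only [IncidenceGeometry.restrict, mem_union, mem_filter]
    constructor
    · intro hB
      rcases h B hB with hs | hd
      · exact Or.inl ⟨hB, hs⟩
      · exact Or.inr ⟨hB, h' B hB hd⟩
    · rintro (hB | hB) <;> exact hB.1

end IncidenceGeometry

namespace CyclicConfiguration

open Finset IncidenceGeometry

/-! ### Cyclic configurations as developments of one triple -/

section Development

variable {v : ℕ}

/-- The translate by `i` of the triple `s`, carried to `Fin v` by `θ`. -/
def line (θ : ZMod v ≃ Fin v) (s : Fin 3 → ZMod v) (i : ZMod v) : Finset (Fin v) :=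
  univ.image fun k => θ (i + s k)

variable {θ θ' : ZMod v ≃ Fin v} {s t : Fin 3 → ZMod v}

theorem apply_mem_line {p i : ZMod v} : θ p ∈ line θ s i ↔ ∃ k, p = i + s k := by
  simp [line, eq_comm]

theorem mem_line {x : Fin v} {i : ZMod v} : x ∈ line θ s i ↔ ∃ k, θ.symm x = i + s k := by
  rw [← apply_mem_line (θ := θ), θ.apply_symm_apply]

theorem line_injective (hs : Sidon s) : Function.Injective (line θ s) := by
  intro i j h
  obtain ⟨a, ha⟩ := apply_mem_line.1 (h ▸ apply_mem_line.2 ⟨0, rfl⟩ : θ (i + s 0) ∈ line θ s j)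
  obtain ⟨b, hb⟩ := apply_mem_line.1 (h ▸ apply_mem_line.2 ⟨1, rfl⟩ : θ (i + s 1) ∈ line θ s j)
  have := (hs 0 1 a b (by decide) (by linear_combination ha - hb)).1
  subst this
  exact add_right_cancel ha

/-- `C` contains `0, h, 2h`. If `2h = 0`, then `C` would be a union of pairs `{x, x + h}`,
impossible for three elements; so these are all of `C`, and stability forces `3h = 0`. -/
theorem eq_of_stable {C : Finset (ZMod v)} (hC : C.card = 3) (h0 : 0 ∈ C) {h : ZMod v}
    (hh : h ≠ 0) (hst : ∀ x ∈ C, x + h ∈ C) : 3 * h = 0 ∧ C = {0, h, -h} := by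
  have h1 : h ∈ C := by simpa using hst 0 h0
  have h2 : h + h ∈ C := hst h h1
  have h2' : h + h ≠ 0 := by
    intro h2'
    have hex : ∃ x ∈ C, x ∉ ({0, h} : Finset (ZMod v)) := by
      refine exists_mem_notMem_of_card_lt_card ?_
      rw [hC, card_pair hh.symm]; norm_num
    obtain ⟨x, hx, hx'⟩ := hex
    simp only [mem_insert, mem_singleton, not_or] at hx'
    have hsub : ({0, h, x, x + h} : Finset (ZMod v)) ⊆ C := by
      intro y hy
      simp only [mem_insert, mem_singleton] at hy
      rcases hy with rfl | rfl | rfl | rfl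
      · exact h0
      · exact h1
      · exact hx
      · exact hst _ hx
    have h4 : ({0, h, x, x + h} : Finset (ZMod v)).card = 4 := by
      rw [card_insert_of_notMem, card_insert_of_notMem, card_pair]
      · simpa using hh
      · simp only [mem_insert, mem_singleton, not_or]
        exact ⟨fun h => hx'.2 h.symm, fun h => hx'.1 (by simpa using h)⟩
      · simp only [mem_insert, mem_singleton, not_or]
        refine ⟨hh.symm, fun h => hx'.1 h.symm, fun h => hx'.2 ?_⟩
        linear_combination -h - h2'
    have := card_le_card hsub
    omega
  have hsub : ({0, h, h + h} : Finset (ZMod v)) ⊆ C := by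
    intro y hy
    simp only [mem_insert, mem_singleton] at hy
    rcases hy with rfl | rfl | rfl
    · exact h0
    · exact h1
    · exact h2
  have h3 : ({0, h, h + h} : Finset (ZMod v)).card = 3 := by
    rw [card_insert_of_notMem, card_pair]
    · simpa using hh
    · simp only [mem_insert, mem_singleton, not_or]
      exact ⟨hh.symm, h2'.symm⟩
  have hCeq := eq_of_subset_of_card_le hsub (by omega)
  have h3h : h + h + h ∈ C := hst _ h2
  have h30 : 3 * h = 0 := by
    rw [← hCeq] at h3h
    simp only [mem_insert, mem_singleton] at h3h
    rcases h3h with h | h | h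
    · linear_combination h
    · exact absurd (by linear_combination h) h2'
    · exact absurd (by linear_combination h) hh
  refine ⟨h30, ?_⟩
  rw [← hCeq, show h + h = -h by linear_combination h30]

variable [NeZero v] {G H : IncidenceGeometry (Fin v)}

/-- `G` is the geometry on `Fin v` whose lines are the translates of the triple `s`. -/
def IsDevelopment (G : IncidenceGeometry (Fin v)) (θ : ZMod v ≃ Fin v) (s : Fin 3 → ZMod v) :
    Prop :=
  G.points = univ ∧ G.lines = univ.image (line θ s)

theorem affineEquivalent_of_isomorphic (hv : 4 < v) (hG : IsDevelopment G θ s)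
    (hH : IsDevelopment H θ' t) (hs : Sidon s) (hs' : Unimodular (diffs s)) (ht : Sidon t)
    (ht' : Unimodular (diffs t)) (h : Isomorphic G H) : AffineEquivalent s t := by
  obtain ⟨F, hF, hFl⟩ := h
  rw [hG.1, hH.1, coe_univ, Set.bijOn_univ] at hF
  rw [hG.2, hH.2] at hFl
  have hg : ∀ i, ∃ j, line θ' t j = (line θ s i).image F := by
    intro i
    have : (line θ s i).image F ∈ univ.image (line θ' t) := by
      rw [← hFl]
      exact mem_image_of_mem _ (mem_image_of_mem _ (mem_univ i))
    simpa using this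
  choose g hg using hg
  have hgi : Function.Injective g := by
    intro i j hij
    apply line_injective (θ := θ) hs
    apply image_injective hF.1
    rw [← hg, ← hg, hij]
  refine affineEquivalent_of_incidence hv hs hs' ht ht'
    (f := (θ.trans (Equiv.ofBijective F hF)).trans θ'.symm)
    (g := Equiv.ofBijective g (Finite.injective_iff_bijective.1 hgi)) fun p i => ?_
  rw [← apply_mem_line (θ := θ), ← apply_mem_line (θ := θ')]
  simp only [Equiv.trans_apply, Equiv.ofBijective_apply, Equiv.apply_symm_apply, hg]
  rw [hF.1.mem_finset_image]

theorem isomorphic_of_affineEquivalent (hG : IsDevelopment G θ s) (hH : IsDevelopment H θ' t)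
    (h : AffineEquivalent s t) : Isomorphic G H := by
  obtain ⟨u, σ, w, h⟩ := h
  refine ⟨fun x => θ' (u * θ.symm x + w), ?_, ?_⟩
  · rw [hG.1, hH.1, coe_univ, Set.bijOn_univ]
    exact ((θ.symm.trans (Units.mulLeft u)).trans ((Equiv.addRight w).trans θ')).bijective
  · rw [hG.2, hH.2, image_image]
    have : (fun B => B.image fun x => θ' (u * θ.symm x + w)) ∘ line θ s =
        line θ' t ∘ fun i => u * i := by
      funext i
      simp only [Function.comp_apply, line, image_image]
      ext x
      simp only [mem_image, mem_univ, true_and, Function.comp_apply, Equiv.symm_apply_apply]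
      have e : ∀ k, u * (i + s k) + w = u * i + t (σ k) := fun k => by rw [h]; ring
      simp only [e]
      constructor
      · rintro ⟨k, rfl⟩; exact ⟨_, rfl⟩
      · rintro ⟨k, rfl⟩; exact ⟨σ.symm k, by simp⟩
    rw [this, ← image_image]
    congr 1
    exact image_univ_of_surjective (Units.mulLeft u).surjective

/-- If the differences generate a proper ideal `I`, every line lies in a single coset of `I`, so the
coset of `s 0` splits off. -/
theorem unimodular_of_isConnected (hG : IsDevelopment G θ s) (hcfg : G.IsConfiguration v 3 v 3)
    (hc : G.IsConnected) : Unimodular (diffs s) := by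
  classical
  by_contra hu
  apply hc
  set I := Ideal.span (Set.range (diffs s)) with hI
  have h1 : (1 : ZMod v) ∉ I := fun h => hu (by
    rw [hI, Ideal.mem_span_range_iff_exists_fun] at h; exact h)
  have hd : ∀ k, s k - s 0 ∈ I := by
    intro k
    by_cases hk : k = 0
    · simp [hk]
    have h' := fun m => Ideal.subset_span (Set.mem_range_self (f := diffs s) m)
    obtain ⟨m, ⟨rfl, h0⟩ | ⟨rfl, h0⟩⟩ := fin_three_side k 0 hk
    · rw [h0]; exact h' m
    · rw [h0, ← neg_sub]; exact I.neg_mem (h' m)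
  have hl : ∀ i, ∀ x ∈ line θ s i, (θ.symm x - s 0 ∈ I ↔ i ∈ I) := by
    intro i x hx
    obtain ⟨k, hk⟩ := mem_line.1 hx
    rw [hk, add_sub_assoc]
    exact I.add_mem_iff_left (hd k)
  refine hcfg.isDecomposable (Q := univ.filter fun x => θ.symm x - s 0 ∈ I)
    (by rw [hG.1]; exact subset_univ _) ⟨θ (s 0), by simp⟩ ⟨θ (s 0 + 1), by simp [hG.1, h1]⟩ ?_
  rw [hG.2]
  intro B hB
  obtain ⟨i, -, rfl⟩ := mem_image.1 hB
  by_cases hi : i ∈ I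
  · exact Or.inl fun x hx => by simpa using (hl i x hx).2 hi
  · exact Or.inr (disjoint_left.2 fun x hx hx' => hi ((hl i x hx).1 (by simpa using hx')))

/-- Two points differing by `s 0 - s j` share a line, hence lie in the same component; such
differences generate `ZMod v`. -/
theorem isConnected_of_unimodular (hG : IsDevelopment G θ s) (hu : Unimodular (diffs s)) :
    G.IsConnected := by
  rintro ⟨G₁, G₂, -, -, ⟨x, hx⟩, ⟨y, hy⟩, hd, -, hl⟩
  have := eq_of_invariant_of_closure_eq_top (hu.closure_eq_top 0)
    (h := fun i => θ i ∈ G₁.points) (by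
      rintro _ ⟨j, rfl⟩ i
      have h1 : θ (i + (s 0 - s j)) ∈ line θ s (i - s j) := apply_mem_line.2 ⟨0, by ring⟩
      have h2 : θ i ∈ line θ s (i - s j) := apply_mem_line.2 ⟨j, by ring⟩
      have h3 : line θ s (i - s j) ∈ G₁.lines ∪ G₂.lines := by
        rw [← hl, hG.2]; exact mem_image_of_mem _ (mem_univ _)
      rcases mem_union.1 h3 with h3 | h3
      · exact propext (iff_of_true (G₁.subset_points _ h3 h1) (G₁.subset_points _ h3 h2))
      · exact propext (iff_of_false (disjoint_right.1 hd (G₂.subset_points _ h3 h1))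
          (disjoint_right.1 hd (G₂.subset_points _ h3 h2)))) (θ.symm x) (θ.symm y)
  simp only [Equiv.apply_symm_apply] at this
  exact disjoint_left.1 hd (this ▸ hx) hy

/-- A repeated difference makes two translates share two points, so they coincide. Having `v` lines
in all means that distinct translates are distinct lines. -/
theorem sidon_of_isConfiguration (hG : IsDevelopment G θ s) (hcfg : G.IsConfiguration v 3 v 3) :
    Sidon s := by
  obtain ⟨-, hb, -, -, hk⟩ := hcfg
  have hlines : ∀ i, line θ s i ∈ G.lines := fun i => by
    rw [hG.2]; exact mem_image_of_mem _ (mem_univ _)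
  have hinj : Function.Injective (line θ s) := by
    rw [hG.2] at hb
    have := card_image_iff.1 (hb.trans (by simp [ZMod.card] : v = (univ : Finset (ZMod v)).card))
    simpa using this
  have hsi : Function.Injective s := by
    have h3 := hk _ (hlines 0)
    have := card_image_iff.1 (h3.trans (by simp : 3 = (univ : Finset (Fin 3)).card))
    intro i j hij
    exact this (by simp) (by simp) (by simp [hij])
  intro i j k l hij h
  have key : line θ s 0 = line θ s (s i - s k) := by
    by_contra hne
    have := G.card_inter_le_one _ (hlines 0) _ (hlines (s i - s k)) hne
    rw [card_le_one] at this
    have := this (θ (s i)) (mem_inter.2 ⟨apply_mem_line.2 ⟨i, by ring⟩, apply_mem_line.2 ⟨k, by ring⟩⟩)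
      (θ (s j)) (mem_inter.2 ⟨apply_mem_line.2 ⟨j, by ring⟩,
        apply_mem_line.2 ⟨l, by linear_combination -h⟩⟩)
    exact hij (hsi (θ.injective this))
  have h0 := hinj key
  exact ⟨hsi (by linear_combination -h0), hsi (by linear_combination -h - h0)⟩

theorem exists_isDevelopment (hs : Sidon s) (θ : ZMod v ≃ Fin v) :
    ∃ G : IncidenceGeometry (Fin v), IsDevelopment G θ s ∧ G.IsConfiguration v 3 v 3 ∧
      G.IsCyclic := by
  have hθ : ∀ i, Function.Injective fun k => θ (i + s k) := fun i a b hab =>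
    hs.injective (add_left_cancel (θ.injective hab))
  refine ⟨⟨univ, univ.image (line θ s), fun _ _ => subset_univ _, ?_⟩, ⟨rfl, rfl⟩, ⟨?_, ?_, le_rfl, ?_, ?_⟩, ?_⟩
  · simp only [mem_image, mem_univ, true_and]
    rintro _ ⟨i, rfl⟩ _ ⟨j, rfl⟩ hne
    rw [card_le_one]
    intro x hx y hy
    rw [mem_inter, mem_line, mem_line] at hx hy
    obtain ⟨⟨a, ha⟩, b, hb⟩ := hx
    obtain ⟨⟨c, hc⟩, d, hd⟩ := hy
    by_contra hxy
    have hac : a ≠ c := by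
      rintro rfl
      exact hxy (θ.symm.injective (ha.trans hc.symm))
    have := (hs a c b d hac (by linear_combination hb - ha - hd + hc)).1
    subst this
    exact hne (by rw [add_right_cancel (ha.symm.trans hb)])
  · simp
  · rw [card_image_of_injective _ (line_injective hs), card_univ, ZMod.card]
  · intro p _
    have : (univ.image (line θ s)).filter (fun B => p ∈ B) =
        univ.image fun k => line θ s (θ.symm p - s k) := by
      ext B
      simp only [mem_filter, mem_image, mem_univ, true_and]
      constructor
      · rintro ⟨⟨i, rfl⟩, hp⟩
        obtain ⟨k, hk⟩ := mem_line.1 hp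
        exact ⟨k, by rw [hk, add_sub_cancel_right]⟩
      · rintro ⟨k, rfl⟩
        exact ⟨⟨_, rfl⟩, mem_line.2 ⟨k, by ring⟩⟩
    change ((univ.image (line θ s)).filter (fun B => p ∈ B)).card = 3
    rw [this, card_image_of_injective, card_univ, Fintype.card_fin]
    intro a b hab
    exact hs.injective (sub_right_injective (line_injective hs hab))
  · simp only [mem_image, mem_univ, true_and]
    rintro _ ⟨i, rfl⟩
    rw [line, card_image_of_injective _ (hθ i), card_univ, Fintype.card_fin]
  · refine ⟨θ.symm.trans ((Equiv.addRight 1).trans θ), ⟨?_, ?_⟩, ?_⟩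
    · simp only [coe_univ, Set.bijOn_univ]
      exact Equiv.bijective _
    · dsimp only
      rw [image_image]
      have : (fun B => B.image (θ.symm.trans ((Equiv.addRight 1).trans θ))) ∘ line θ s =
          line θ s ∘ fun i => i + 1 := by
        funext i
        simp only [Function.comp_apply, line, image_image]
        congr 1
        funext k
        simp only [Function.comp_apply, Equiv.trans_apply, Equiv.symm_apply_apply,
          Equiv.coe_addRight]
        congr 1; ring
      rw [this, ← image_image]
      congr 1
      exact image_univ_of_surjective (Equiv.addRight (1 : ZMod v)).surjective
    · simp only [coe_univ]
      refine ⟨Set.bijOn_univ.2 (Equiv.bijective _), fun x _ y _ => ?_⟩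
      have hpow : ∀ n : ℕ, ∀ x, ((θ.symm.trans ((Equiv.addRight 1).trans θ) : Equiv.Perm _) ^ n) x =
          θ (θ.symm x + n) := by
        intro n
        induction n with
        | zero => simp
        | succ n ih =>
          intro x
          rw [pow_succ', Equiv.Perm.mul_apply, ih]
          simp [add_assoc]
      refine ⟨((θ.symm y - θ.symm x).val : ℕ), ?_⟩
      rw [zpow_natCast, hpow]
      simp

/-- A cyclic group has at most one subgroup of order 3. -/
theorem eq_or_eq_neg_of_three_mul {h h' : ZMod v} (hh : 3 * h = 0) (hn : h ≠ 0) (hh' : 3 * h' = 0)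
    (hn' : h' ≠ 0) : h' = h ∨ h' = -h := by
  have key : ∀ x : ZMod v, 3 * x = 0 → x ≠ 0 → 3 * x.val = v ∨ 3 * x.val = 2 * v := by
    intro x hx hx0
    have h1 : ((3 * x.val : ℕ) : ZMod v) = 0 := by
      push_cast; rw [ZMod.natCast_zmod_val, hx]
    obtain ⟨c, hc⟩ := (ZMod.natCast_eq_zero_iff _ _).1 h1
    have h2 := ZMod.val_lt x
    have h3 : x.val ≠ 0 := by simpa using hx0
    have hc3 : c < 3 := by
      by_contra hc3
      have : v * 3 ≤ v * c := Nat.mul_le_mul_left _ (by omega)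
      omega
    interval_cases c
    · omega
    · left; omega
    · right; omega
  have e : ∀ x y : ZMod v, x.val + y.val = v → y = -x := by
    intro x y hxy
    have : ((x.val + y.val : ℕ) : ZMod v) = 0 := by rw [hxy, ZMod.natCast_self]
    push_cast at this
    rw [ZMod.natCast_zmod_val, ZMod.natCast_zmod_val] at this
    linear_combination this
  rcases key h hh hn with h1 | h1 <;> rcases key h' hh' hn' with h2 | h2
  · left; apply ZMod.val_injective; omega
  · right; apply e; omega
  · right; apply e; omega
  · left; apply ZMod.val_injective; omega

theorem exists_equiv_of_isCycleOn {σ : Equiv.Perm (Fin v)} (hσ : σ.IsCycleOn Set.univ) :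
    ∃ θ : ZMod v ≃ Fin v, ∀ (n : ℕ) x, (σ ^ n) (θ x) = θ (x + n) := by
  have hσ' : σ.IsCycleOn (univ : Finset (Fin v)) := by rwa [coe_univ]
  let F : ZMod v → Fin v := fun x => (σ ^ x.val) 0
  have hF : Function.Surjective F := by
    intro y
    obtain ⟨n, hn, h⟩ := hσ'.exists_pow_eq (mem_univ 0) (mem_univ y)
    refine ⟨n, ?_⟩
    rw [card_univ, Fintype.card_fin] at hn
    change (σ ^ (n : ZMod v).val) 0 = y
    rw [ZMod.val_cast_of_lt hn, h]
  have hbij : Function.Bijective F :=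
    (Fintype.bijective_iff_surjective_and_card _).2 ⟨hF, by rw [ZMod.card, Fintype.card_fin]⟩
  refine ⟨Equiv.ofBijective F hbij, fun n x => ?_⟩
  change (σ ^ n) ((σ ^ x.val) 0) = (σ ^ (x + n).val) 0
  rw [← Equiv.Perm.mul_apply, ← pow_add, hσ'.pow_apply_eq_pow_apply (mem_univ 0), card_univ,
    Fintype.card_fin, ← ZMod.natCast_eq_natCast_iff]
  push_cast
  rw [ZMod.natCast_zmod_val, ZMod.natCast_zmod_val, add_comm]

theorem exists_isDevelopment_of_isCyclic (hcfg : G.IsConfiguration v 3 v 3) (hc : G.IsCyclic) :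
    ∃ θ s, IsDevelopment G θ s := by
  obtain ⟨hp, hb, -, hr, hk⟩ := hcfg
  have hp' : G.points = univ := by rw [← card_eq_iff_eq_univ, hp, Fintype.card_fin]
  obtain ⟨σ, ⟨-, hσl⟩, hσc⟩ := hc
  rw [hp', coe_univ] at hσc
  obtain ⟨θ, hθ⟩ := exists_equiv_of_isCycleOn hσc
  have hpow : ∀ (n : ℕ), ∀ B ∈ G.lines, B.image (σ ^ n : Equiv.Perm (Fin v)) ∈ G.lines := by
    intro n
    induction n with
    | zero => intro B hB; simpa using hB
    | succ n ih =>
      intro B hB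
      have := mem_image_of_mem (fun B => B.image σ) (ih B hB)
      rw [hσl, image_image] at this
      rwa [pow_succ', Equiv.Perm.coe_mul]
  let T : Finset (Fin v) → ZMod v → Finset (Fin v) := fun B i => B.image fun x => θ (θ.symm x + i)
  have hT : ∀ B ∈ G.lines, ∀ i, T B i ∈ G.lines := by
    intro B hB i
    have := hpow i.val B hB
    convert this using 2
    funext x
    have := hθ i.val (θ.symm x)
    rw [θ.apply_symm_apply, ZMod.natCast_zmod_val] at this
    exact this.symm
  have hTm : ∀ B i x, θ x ∈ T B i ↔ θ (x - i) ∈ B := by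
    intro B i x
    simp only [T, mem_image]
    constructor
    · rintro ⟨y, hy, h⟩
      rw [← θ.injective h]; simpa using hy
    · intro h
      exact ⟨_, h, by simp⟩
  -- Otherwise every line is stable under a nonzero translation, so every line through `θ 0` is the
  -- unique subgroup of order 3; but there are three such lines.
  have main : ∃ B ∈ G.lines, Function.Injective (T B) := by
    by_contra! hcon
    have hst : ∀ B ∈ G.lines, θ 0 ∈ B →
        ∃ h : ZMod v, h ≠ 0 ∧ 3 * h = 0 ∧ B.image θ.symm = {0, h, -h} := by
      intro B hB hB0
      have hni := hcon B hB
      unfold Function.Injective at hni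
      push Not at hni
      obtain ⟨i, j, hij, hne⟩ := hni
      have hh : j - i ≠ 0 := sub_ne_zero.2 (Ne.symm hne)
      refine ⟨j - i, hh, eq_of_stable (by rw [card_image_of_injective _ θ.symm.injective, hk B hB])
        (mem_image.2 ⟨_, hB0, by simp⟩) hh ?_⟩
      intro x hx
      obtain ⟨y, hy, rfl⟩ := mem_image.1 hx
      have h1 : θ (θ.symm y + j) ∈ T B j := (hTm _ _ _).2 (by simpa using hy)
      rw [← hij, hTm] at h1
      exact mem_image.2 ⟨_, h1, by simp [add_sub_assoc]⟩
    have h3 := hr (θ 0) (by rw [hp']; exact mem_univ _)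
    obtain ⟨B, hB, B', hB', hne⟩ := one_lt_card.1 (h3 ▸ (by norm_num : 1 < 3))
    rw [mem_filter] at hB hB'
    obtain ⟨h, hh, h3h, hBe⟩ := hst B hB.1 hB.2
    obtain ⟨h', hh', h3h', hBe'⟩ := hst B' hB'.1 hB'.2
    apply hne
    apply image_injective θ.symm.injective
    rw [hBe, hBe']
    rcases eq_or_eq_neg_of_three_mul h3h hh h3h' hh' with rfl | rfl
    · rfl
    · rw [neg_neg, pair_comm]
  obtain ⟨B, hB, hinj⟩ := main
  -- The `v` distinct translates of `B` exhaust the `v` lines.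
  have hlines : univ.image (T B) = G.lines := by
    refine eq_of_subset_of_card_le (fun C hC => ?_) ?_
    · obtain ⟨i, -, rfl⟩ := mem_image.1 hC
      exact hT B hB i
    · rw [card_image_of_injective _ hinj, card_univ, ZMod.card, hb]
  obtain ⟨x, y, z, -, -, -, hBe⟩ := card_eq_three.1 (hk B hB)
  refine ⟨θ, ![θ.symm x, θ.symm y, θ.symm z], hp', ?_⟩
  rw [← hlines]
  congr 1
  funext i
  ext w
  simp [T, line, hBe, Fin.exists_fin_succ, add_comm, eq_comm]

end Development

/-! ### Configurations as nondegenerate orbits; the degenerate orbits -/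

section Orbits

variable {v : ℕ}

/-- The possible differences of generating triples in `ZMod v`. -/
def UnimodularTriple (v : ℕ) : Type :=
  {d : Fin 3 → ZMod v // ∑ i, d i = 0 ∧ Unimodular d}

instance : MulAction ((ZMod v)ˣ × Equiv.Perm (Fin 3)) (UnimodularTriple v) where
  smul g d := ⟨fun k => g.1 * d.1 (g.2⁻¹ k), by
    obtain ⟨d, hd, a, ha⟩ := d
    refine ⟨?_, fun k => ↑g.1⁻¹ * a (g.2⁻¹ k), ?_⟩
    · dsimp only
      rw [← mul_sum, Equiv.sum_comp g.2⁻¹ d, hd, mul_zero]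
    · dsimp only
      rw [← ha, ← Equiv.sum_comp g.2⁻¹ fun k => a k * d k]
      refine sum_congr rfl fun k _ => ?_
      linear_combination (a (g.2⁻¹ k) * d (g.2⁻¹ k)) * g.1.inv_mul⟩
  one_smul d := Subtype.ext (funext fun k => by
    change ((1 : (ZMod v)ˣ) : ZMod v) * d.1 k = d.1 k
    simp)
  mul_smul g h d := Subtype.ext (funext fun k => by
    change ((g.1 * h.1 : (ZMod v)ˣ) : ZMod v) * d.1 ((g.2 * h.2)⁻¹ k) =
      g.1 * (h.1 * d.1 (h.2⁻¹ (g.2⁻¹ k)))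
    rw [mul_inv_rev, Equiv.Perm.mul_apply, Units.val_mul, mul_assoc])

theorem smul_val (g : (ZMod v)ˣ × Equiv.Perm (Fin 3)) (d : UnimodularTriple v) (k : Fin 3) :
    (g • d).1 k = g.1 * d.1 (g.2⁻¹ k) := rfl

/-- Orbits of difference triples under scaling and reordering. -/
abbrev Orbit (v : ℕ) : Type :=
  Quotient (MulAction.orbitRel ((ZMod v)ˣ × Equiv.Perm (Fin 3)) (UnimodularTriple v))

/-- The orbit of a difference triple. -/
def orbit (d : UnimodularTriple v) : Orbit v := Quotient.mk _ d

theorem orbit_eq_iff {d e : UnimodularTriple v} : orbit d = orbit e ↔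
    ∃ (u : (ZMod v)ˣ) (σ : Equiv.Perm (Fin 3)), ∀ k, e.1 (σ k) = u * d.1 k := by
  rw [eq_comm]
  refine Quotient.eq.trans (MulAction.orbitRel_apply.trans ?_)
  constructor
  · rintro ⟨g, rfl⟩
    refine ⟨g.1, g.2, fun k => ?_⟩
    simp only [smul_val]
    simp
  · rintro ⟨u, σ, h⟩
    refine ⟨(u, σ), Subtype.ext (funext fun k => ?_)⟩
    have := h (σ⁻¹ k)
    rw [show σ (σ⁻¹ k) = k by simp] at this
    simp only [smul_val]
    exact this.symm

theorem nondegenerate_of_orbit_eq {d e : UnimodularTriple v} (h : orbit d = orbit e)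
    (he : Nondegenerate e.1) : Nondegenerate d.1 := by
  obtain ⟨u, σ, h⟩ := orbit_eq_iff.1 h
  refine ⟨fun i j hij hd => he.1 (σ i) (σ j) (σ.injective.ne hij) (by rw [h, h, hd]),
    fun i hi => he.2 (σ i) ?_⟩
  rw [h]
  linear_combination u * hi

/-- The difference triple `(a, 1, -1 - a)`. -/
def baseTriple (a : ZMod v) : UnimodularTriple v :=
  ⟨![a, 1, -1 - a], by simp [Fin.sum_univ_three]; ring, ![0, 1, 0], by simp [Fin.sum_univ_three]⟩

theorem fin_three_forall {P : Fin 3 → Prop} {i j k : Fin 3} (hij : i ≠ j) (hjk : j ≠ k)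
    (hik : i ≠ k) (hi : P i) (hj : P j) (hk : P k) (m : Fin 3) : P m := by
  have : m = i ∨ m = j ∨ m = k := by clear hi hj hk; revert i j k m; decide
  rcases this with rfl | rfl | rfl <;> assumption

theorem UnimodularTriple.isUnit_of_eq_mul {d : UnimodularTriple v} {i j k : Fin 3} (hij : i ≠ j)
    (hjk : j ≠ k) (hik : i ≠ k) {a : ZMod v} (h : d.1 i = a * d.1 j) :
    d.1 k = (-1 - a) * d.1 j ∧ IsUnit (d.1 j) := by
  have hk : d.1 k = (-1 - a) * d.1 j := by
    have := d.2.1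
    rw [sum_fin_three _ hij hik hjk] at this
    linear_combination this - h
  exact ⟨hk, d.2.2.isUnit_of_dvd (fin_three_forall hij hjk hik ⟨a, by rw [h, mul_comm]⟩ dvd_rfl
    ⟨_, hk.trans (mul_comm _ _)⟩)⟩

/-- If one side is a multiple of another, so is the third, and unimodularity makes that other side a
unit, which can be scaled to 1. -/
theorem orbit_eq_orbit_baseTriple {d : UnimodularTriple v} {i j : Fin 3} (hij : i ≠ j) {a : ZMod v}
    (h : d.1 i = a * d.1 j) : orbit d = orbit (baseTriple a) := by
  obtain ⟨k, hki, hkj, -⟩ := fin_three_exists_third i j hij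
  obtain ⟨hk, u, hu⟩ := d.isUnit_of_eq_mul hij hkj.symm hki.symm h
  obtain ⟨σ, h0, h1, h2⟩ := perm_fin_three_exists i j k hij hkj.symm hki.symm
  refine orbit_eq_iff.2 ⟨u⁻¹, σ, fin_three_forall hij hkj.symm hki.symm ?_ ?_ ?_⟩
  · rw [h0, h, ← hu, mul_left_comm, u.inv_mul, mul_one]; rfl
  · rw [h1, ← hu, u.inv_mul]; rfl
  · rw [h2, hk, ← hu, mul_left_comm, u.inv_mul, mul_one]; rfl

theorem affineEquivalent_iff_orbit_eq {s t : Fin 3 → ZMod v} {d e : UnimodularTriple v}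
    (hs : diffs s = d.1) (ht : diffs t = e.1) : AffineEquivalent s t ↔ orbit d = orbit e := by
  rw [affineEquivalent_iff_diffs, orbit_eq_iff, hs, ht]

theorem baseTriple_val (a : ZMod v) : (baseTriple a).1 = ![a, 1, -1 - a] := rfl

theorem orbit_baseTriple_zero_ne {a : ZMod v} (ha : a ≠ 0) (ha' : a ≠ -1) (hv : 4 < v) :
    orbit (baseTriple 0) ≠ orbit (baseTriple a) := by
  intro h
  obtain ⟨u, σ, h⟩ := orbit_eq_iff.1 h
  have h0 := h 0
  simp only [baseTriple_val, Fin.isValue, Matrix.cons_val_zero, mul_zero] at h0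
  have : Fact (1 < v) := ⟨by omega⟩
  generalize σ 0 = m at h0
  fin_cases m
  · exact ha h0
  · simp at h0
  · exact ha' (by simp at h0; linear_combination -h0)

theorem natCast_ne_zero_of_lt {n : ℕ} (h0 : 0 < n) (hn : n < v) : (n : ZMod v) ≠ 0 := by
  rw [Ne, ZMod.natCast_eq_zero_iff]
  exact Nat.not_dvd_of_pos_of_lt h0 hn

/-- The three cases are a vanishing side, two equal sides, and a side of order exactly two. -/
theorem degenerate_cases {d : UnimodularTriple v} (hd : ¬ Nondegenerate d.1) :
    orbit d = orbit (baseTriple 0) ∨ orbit d = orbit (baseTriple 1) ∨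
      ∃ i, 2 * d.1 i = 0 ∧ d.1 i ≠ 0 := by
  unfold Nondegenerate at hd
  push Not at hd
  by_cases h : ∃ i j, i ≠ j ∧ d.1 i = d.1 j
  · obtain ⟨i, j, hij, h⟩ := h
    exact Or.inr (Or.inl (orbit_eq_orbit_baseTriple hij (by rw [h, one_mul])))
  · push Not at h
    obtain ⟨i, hi⟩ := hd h
    by_cases hi0 : d.1 i = 0
    · refine Or.inl (orbit_eq_orbit_baseTriple (i := i) (j := i + 1) (by clear * -; revert i; decide) ?_)
      rw [hi0, zero_mul]
    · exact Or.inr (Or.inr ⟨i, hi, hi0⟩)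

theorem not_two_torsion_of_odd (hv : Odd v) {x : ZMod v} (hx : 2 * x = 0) : x = 0 := by
  have : IsUnit ((2 : ℕ) : ZMod v) := by
    rw [ZMod.isUnit_iff_coprime]; exact Nat.coprime_two_left.2 hv
  push_cast at this
  exact (this.mul_right_eq_zero).1 hx

theorem not_nondegenerate_baseTriple_zero : ¬ Nondegenerate (baseTriple (0 : ZMod v)).1 :=
  fun h => h.2 0 (by simp [baseTriple_val])

theorem not_nondegenerate_baseTriple_one : ¬ Nondegenerate (baseTriple (1 : ZMod v)).1 :=
  fun h => h.1 0 1 (by decide) (by simp [baseTriple_val])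

variable [NeZero v]

theorem exists_triple (G : ConnectedCyclicConfiguration v 3) : ∃ (d : UnimodularTriple v),
    Nondegenerate d.1 ∧ ∃ θ s, IsDevelopment G.1 θ s ∧ diffs s = d.1 := by
  obtain ⟨G, hcfg, hconn, hcyc⟩ := G
  obtain ⟨θ, s, hs⟩ := exists_isDevelopment_of_isCyclic hcfg hcyc
  exact ⟨⟨diffs s, sum_diffs s, unimodular_of_isConnected hs hcfg hconn⟩,
    sidon_iff_nondegenerate.1 (sidon_of_isConfiguration hs hcfg), θ, s, hs, rfl⟩

/-- The orbit of difference triples attached to a configuration. -/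
noncomputable def configurationOrbit (G : ConnectedCyclicConfiguration v 3) : Orbit v :=
  orbit (exists_triple G).choose

theorem configurationOrbit_spec (G : ConnectedCyclicConfiguration v 3) :
    ∃ d : UnimodularTriple v, configurationOrbit G = orbit d ∧ Nondegenerate d.1 ∧
      ∃ θ s, IsDevelopment G.1 θ s ∧ diffs s = d.1 :=
  ⟨_, rfl, (exists_triple G).choose_spec⟩

theorem isomorphic_iff_orbit_eq (hv : 4 < v) {G H : IncidenceGeometry (Fin v)}
    {θ θ' : ZMod v ≃ Fin v} {s t : Fin 3 → ZMod v} {d e : UnimodularTriple v}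
    (hG : IsDevelopment G θ s) (hH : IsDevelopment H θ' t) (hs : diffs s = d.1)
    (ht : diffs t = e.1) (hd : Nondegenerate d.1) (he : Nondegenerate e.1) :
    IncidenceGeometry.Isomorphic G H ↔ orbit d = orbit e := by
  rw [← affineEquivalent_iff_orbit_eq hs ht]
  have hd' := d.2.2
  have he' := e.2.2
  rw [← hs] at hd hd'
  rw [← ht] at he he'
  exact ⟨affineEquivalent_of_isomorphic hv hG hH (sidon_iff_nondegenerate.2 hd) hd'
    (sidon_iff_nondegenerate.2 he) he', isomorphic_of_affineEquivalent hG hH⟩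

/-- By rigidity, the arbitrary choice of cycle and base triple in `configurationOrbit` does not
affect the orbit. -/
theorem configurationOrbit_eq_iff (hv : 4 < v) {G H : ConnectedCyclicConfiguration v 3} :
    configurationOrbit G = configurationOrbit H ↔ IncidenceGeometry.Isomorphic G.1 H.1 := by
  obtain ⟨d, hd, hdn, θ, s, hG, hs⟩ := configurationOrbit_spec G
  obtain ⟨e, he, hen, θ', t, hH, ht⟩ := configurationOrbit_spec H
  rw [hd, he, isomorphic_iff_orbit_eq hv hG hH hs ht hdn hen]

theorem mem_range_configurationOrbit (hv : 4 < v) {d : UnimodularTriple v} :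
    orbit d ∈ Set.range (configurationOrbit (v := v)) ↔ Nondegenerate d.1 := by
  constructor
  · rintro ⟨G, hG⟩
    obtain ⟨e, he, hen, -⟩ := configurationOrbit_spec G
    exact nondegenerate_of_orbit_eq (hG.symm.trans he) hen
  · intro hd
    obtain ⟨s, hs⟩ := exists_diffs_eq d.2.1
    have hs' : Sidon s := sidon_iff_nondegenerate.2 (hs ▸ hd)
    obtain ⟨G, hG, hcfg, hcyc⟩ := exists_isDevelopment hs' (ZMod.finEquiv v).symm.toEquiv
    refine ⟨⟨G, hcfg, isConnected_of_unimodular hG (hs ▸ d.2.2), hcyc⟩, ?_⟩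
    obtain ⟨e, he, hen, θ, t, hG', ht⟩ := configurationOrbit_spec
      ⟨G, hcfg, isConnected_of_unimodular hG (hs ▸ d.2.2), hcyc⟩
    rw [he, ← isomorphic_iff_orbit_eq hv hG' hG ht hs hen hd]
    exact IncidenceGeometry.Isomorphic.refl G

theorem numConnectedCyclic_eq_ncard (hv : 4 < v) :
    numConnectedCyclic v 3 = (Set.range (configurationOrbit (v := v))).ncard := by
  have : isomorphismSetoid v 3 = Setoid.ker (configurationOrbit (v := v)) := by
    ext G H
    exact (configurationOrbit_eq_iff hv).symm
  unfold numConnectedCyclic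
  rw [this, Nat.card_congr (Setoid.quotientKerEquivRange _), Nat.card_coe_set_eq]

instance : Finite (UnimodularTriple v) := Subtype.finite

theorem numConnectedCyclic_add_ncard (hv : 4 < v) :
    numConnectedCyclic v 3 + (Set.range (configurationOrbit (v := v)))ᶜ.ncard =
      Nat.card (Orbit v) := by
  rw [numConnectedCyclic_eq_ncard hv, Set.ncard_add_ncard_compl]

theorem eq_half_of_two_mul_eq_zero {m : ℕ} (hm : v = 2 * m) {x : ZMod v} (hx : 2 * x = 0)
    (hx0 : x ≠ 0) : x = m := by
  have h1 : ((2 * x.val : ℕ) : ZMod v) = 0 := by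
    push_cast; rw [ZMod.natCast_zmod_val, hx]
  obtain ⟨c, hc⟩ := (ZMod.natCast_eq_zero_iff _ _).1 h1
  have h2 := ZMod.val_lt x
  have h3 : x.val ≠ 0 := by simpa using hx0
  have hc2 : c < 2 := by
    by_contra hc2
    have : v * 2 ≤ v * c := Nat.mul_le_mul_left _ (by omega)
    omega
  interval_cases c
  · omega
  · rw [← ZMod.natCast_zmod_val x]; congr 1; omega

/-- If a side of a generating triangle is the involution, another side is a unit. -/
theorem isUnit_or_isUnit_of_half {m : ℕ} (hm : v = 2 * m) {d : UnimodularTriple v} {i j k : Fin 3}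
    (hij : i ≠ j) (hjk : j ≠ k) (hik : i ≠ k) (hi : d.1 i = m) :
    IsUnit (d.1 j) ∨ IsUnit (d.1 k) := by
  set y := (d.1 j).val with hy
  have hyj : d.1 j = (y : ℕ) := (ZMod.natCast_zmod_val _).symm
  have hk : d.1 k = -((y + m : ℕ) : ZMod v) := by
    have := d.2.1
    rw [sum_fin_three _ hij hik hjk, hi, hyj] at this
    push_cast
    linear_combination this
  -- Modulo `m` the sides become `0, y, -y`, so unimodularity says that `y` is invertible there.
  have hcop : y.Coprime m := by
    rw [← ZMod.isUnit_iff_coprime]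
    obtain ⟨a, ha⟩ := d.2.2
    rw [sum_fin_three _ hij hik hjk, hi, hk, hyj] at ha
    have := congrArg (ZMod.castHom (⟨2, by rw [hm, mul_comm]⟩ : m ∣ v) (ZMod m)) ha
    rw [map_add, map_add, map_mul, map_mul, map_mul, map_neg, map_natCast, map_natCast, map_natCast,
      map_one, ZMod.natCast_self, Nat.cast_add, ZMod.natCast_self] at this
    refine IsUnit.of_mul_eq_one
      (ZMod.castHom (⟨2, by rw [hm, mul_comm]⟩ : m ∣ v) (ZMod m) (a j) -
       ZMod.castHom (⟨2, by rw [hm, mul_comm]⟩ : m ∣ v) (ZMod m) (a k)) ?_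
    linear_combination this
  rw [hyj, hk, IsUnit.neg_iff, ZMod.isUnit_iff_coprime, ZMod.isUnit_iff_coprime]
  -- Only the factor 2 of `v = 2 * m` remains. If `y` is even, `m` is odd by coprimality, and `y +
  -- m` is odd.
  rcases Nat.even_or_odd y with he | ho
  · right
    have hmo : Odd m := by
      rw [← Nat.not_even_iff_odd]
      intro hme
      have := Nat.dvd_gcd he.two_dvd hme.two_dvd
      rw [hcop] at this
      omega
    rw [hm]
    exact Nat.Coprime.mul_right (Nat.coprime_two_right.2 (he.add_odd hmo)) (by simpa using hcop)
  · left
    rw [hm]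
    exact Nat.Coprime.mul_right (Nat.coprime_two_right.2 ho) hcop

theorem orbit_eq_of_half {m : ℕ} (hm : v = 2 * m) {d : UnimodularTriple v} {i : Fin 3}
    (hi : 2 * d.1 i = 0) (hi0 : d.1 i ≠ 0) : orbit d = orbit (baseTriple (m : ZMod v)) := by
  have key : ∀ j, i ≠ j → IsUnit (d.1 j) → orbit d = orbit (baseTriple (m : ZMod v)) := by
    rintro j hij ⟨u, hu⟩
    refine orbit_eq_orbit_baseTriple hij ?_
    have h : d.1 i * ↑u⁻¹ = m := by
      refine eq_half_of_two_mul_eq_zero hm (by linear_combination ↑u⁻¹ * hi) ?_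
      rwa [Ne, Units.mul_left_eq_zero]
    rw [← h, ← hu, mul_assoc, u.inv_mul, mul_one]
  have h1 : i ≠ i + 1 := by clear * -; revert i; decide
  have h2 : i + 1 ≠ i + 2 := by clear * -; revert i; decide
  have h3 : i ≠ i + 2 := by clear * -; revert i; decide
  rcases isUnit_or_isUnit_of_half hm h1 h2 h3 (eq_half_of_two_mul_eq_zero hm hi hi0) with h | h
  · exact key _ h1 h
  · exact key _ h3 h

theorem ncard_degenerate_of_odd (hv : 4 < v) (ho : Odd v) :
    (Set.range (configurationOrbit (v := v)))ᶜ.ncard = 2 := by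
  have : (Set.range (configurationOrbit (v := v)))ᶜ =
      {orbit (baseTriple 0), orbit (baseTriple 1)} := by
    ext q
    obtain ⟨d, rfl⟩ := Quotient.exists_rep q
    change orbit d ∈ _ ↔ orbit d ∈ _
    rw [Set.mem_compl_iff, mem_range_configurationOrbit hv, Set.mem_insert_iff,
      Set.mem_singleton_iff]
    constructor
    · intro h
      rcases degenerate_cases h with h | h | ⟨i, hi, hi0⟩
      · exact Or.inl h
      · exact Or.inr h
      · exact absurd (not_two_torsion_of_odd ho hi) hi0
    · rintro (h | h) hn
      · exact not_nondegenerate_baseTriple_zero (nondegenerate_of_orbit_eq h.symm hn)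
      · exact not_nondegenerate_baseTriple_one (nondegenerate_of_orbit_eq h.symm hn)
  rw [this]
  have h1 := natCast_ne_zero_of_lt (v := v) (n := 1) (by norm_num) (by omega)
  have h2 := natCast_ne_zero_of_lt (v := v) (n := 2) (by norm_num) (by omega)
  push_cast at h1 h2
  exact Set.ncard_pair (orbit_baseTriple_zero_ne h1 (fun h => h2 (by linear_combination h)) hv)

theorem ncard_degenerate_of_even (hv : 4 < v) (he : Even v) :
    (Set.range (configurationOrbit (v := v)))ᶜ.ncard = 3 := by
  obtain ⟨m, hm⟩ := he.two_dvd
  have h1 := natCast_ne_zero_of_lt (v := v) (n := 1) (by norm_num) (by omega)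
  have h2 := natCast_ne_zero_of_lt (v := v) (n := 2) (by norm_num) (by omega)
  have h3 := natCast_ne_zero_of_lt (v := v) (n := 4) (by norm_num) (by omega)
  have hm0 := natCast_ne_zero_of_lt (v := v) (n := m) (by omega) (by omega)
  have hmm : 2 * (m : ZMod v) = 0 := by
    have : ((2 * m : ℕ) : ZMod v) = 0 := by rw [← hm, ZMod.natCast_self]
    exact_mod_cast this
  push_cast at h1 h2 h3
  have hdeg : ¬ Nondegenerate (baseTriple (m : ZMod v)).1 := fun h => h.2 0 hmm
  have hset : (Set.range (configurationOrbit (v := v)))ᶜ =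
      {orbit (baseTriple 0), orbit (baseTriple 1), orbit (baseTriple (m : ZMod v))} := by
    ext q
    obtain ⟨d, rfl⟩ := Quotient.exists_rep q
    change orbit d ∈ _ ↔ orbit d ∈ _
    rw [Set.mem_compl_iff, mem_range_configurationOrbit hv, Set.mem_insert_iff, Set.mem_insert_iff,
      Set.mem_singleton_iff]
    constructor
    · intro h
      rcases degenerate_cases h with h | h | ⟨i, hi, hi0⟩
      · exact Or.inl h
      · exact Or.inr (Or.inl h)
      · exact Or.inr (Or.inr (orbit_eq_of_half hm hi hi0))
    · rintro (h | h | h) hn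
      · exact not_nondegenerate_baseTriple_zero (nondegenerate_of_orbit_eq h.symm hn)
      · exact not_nondegenerate_baseTriple_one (nondegenerate_of_orbit_eq h.symm hn)
      · exact hdeg (nondegenerate_of_orbit_eq h.symm hn)
  rw [hset]
  refine Set.ncard_eq_three.2 ⟨_, _, _, ?_, ?_, ?_, rfl⟩
  · exact orbit_baseTriple_zero_ne h1 (fun h => h2 (by linear_combination h)) hv
  · exact orbit_baseTriple_zero_ne hm0 (fun h => h2 (by linear_combination 2 * h - hmm)) hv
  -- `(1, 1, -2)` has two equal entries, whereas those of `(m, 1, -1 - m)` are pairwise distinct;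
  -- this is where `4 ≠ 0` in `ZMod v` is needed.
  · intro h
    obtain ⟨u, σ, h⟩ := orbit_eq_iff.1 h
    have hσ : σ 0 ≠ σ 1 := σ.injective.ne (by decide)
    have h01 : (baseTriple (m : ZMod v)).1 (σ 0) = (baseTriple (m : ZMod v)).1 (σ 1) := by
      rw [h 0, h 1]; rfl
    simp only [baseTriple_val] at h01
    generalize σ 0 = a at *
    generalize σ 1 = b at *
    have e1 : (m : ZMod v) ≠ 1 := fun h => h2 (by linear_combination hmm - 2 * h)
    have e2 : (m : ZMod v) ≠ -1 - m := fun h => h1 (by linear_combination h - hmm)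
    have e3 : (1 : ZMod v) ≠ -1 - m := fun h => h3 (by linear_combination 2 * h - hmm)
    clear h hset
    fin_cases a <;> fin_cases b <;> simp at h01 hσ
    · exact e1 h01
    · exact e2 h01
    · exact e1 h01.symm
    · exact e3 h01
    · exact e2 h01.symm
    · exact e3 h01.symm

end Orbits

/-! ### Fixed points and Burnside's lemma -/

section Burnside

variable {v : ℕ}

/-- Such a triple is determined by `d i`, which must be a unit and may be any unit. -/
theorem natCard_ratio [NeZero v] {i j k : Fin 3} (hij : i ≠ j) (hjk : j ≠ k) (hik : i ≠ k)
    (u : ZMod v) : Nat.card {d : UnimodularTriple v // d.1 j = u * d.1 i} = v.totient := by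
  rw [← ZMod.card_units_eq_totient, ← Nat.card_eq_fintype_card]
  refine Nat.card_congr (Equiv.ofBijective (fun d => (d.1.isUnit_of_eq_mul hij.symm hik hjk d.2).2.unit)
    ⟨fun d e h => ?_, fun x => ?_⟩)
  · have h' : d.1.1 i = e.1.1 i := congrArg Units.val h
    refine Subtype.ext (Subtype.ext (funext (fin_three_forall hij hjk hik h' ?_ ?_)))
    · rw [d.2, e.2, h']
    · rw [(d.1.isUnit_of_eq_mul hij.symm hik hjk d.2).1, (e.1.isUnit_of_eq_mul hij.symm hik hjk e.2).1,
        h']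
  · refine ⟨⟨⟨fun m => if m = i then x else if m = j then u * x else (-1 - u) * x, ?_,
      fun m => if m = i then ↑x⁻¹ else 0, ?_⟩, ?_⟩, Units.ext ?_⟩
    · rw [sum_fin_three _ hij hik hjk]
      simp only [if_true, hij.symm, hik.symm, hjk.symm, if_false]
      ring
    · rw [sum_eq_single i (fun m _ hm => by simp [hm]) (by simp)]
      simp
    · simp [hij.symm]
    · simp

variable (v) in
/-- The number of difference triples fixed by a scaling combined with a reordering. -/
noncomputable def fixedCount (u : (ZMod v)ˣ) (σ : Equiv.Perm (Fin 3)) : ℕ :=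
  Nat.card (MulAction.fixedBy (UnimodularTriple v) (u, σ))

theorem mem_fixedBy_iff {u : (ZMod v)ˣ} {σ : Equiv.Perm (Fin 3)} {d : UnimodularTriple v} :
    d ∈ MulAction.fixedBy (UnimodularTriple v) (u, σ) ↔ ∀ k, d.1 (σ k) = u * d.1 k := by
  rw [MulAction.mem_fixedBy]
  constructor
  · intro h k
    have := congrArg (fun d => d.1 (σ k)) h
    simp only [smul_val] at this
    simpa using this.symm
  · intro h
    refine Subtype.ext (funext fun k => ?_)
    have := h (σ⁻¹ k)
    rw [show σ (σ⁻¹ k) = k by simp] at this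
    simp only [smul_val]
    exact this.symm

/-- Scaling by `u` fixes a unimodular triple only if it fixes the combination `1` of its entries. -/
theorem fixedCount_one (u : (ZMod v)ˣ) :
    fixedCount v u 1 = if u = 1 then Nat.card (UnimodularTriple v) else 0 := by
  unfold fixedCount
  split_ifs with h
  · subst h
    have : MulAction.fixedBy (UnimodularTriple v) ((1 : (ZMod v)ˣ), (1 : Equiv.Perm (Fin 3))) =
        Set.univ := MulAction.fixedBy_one_eq_univ _ _
    rw [this]
    exact Nat.card_congr (Equiv.Set.univ _)
  · have : IsEmpty (MulAction.fixedBy (UnimodularTriple v) (u, (1 : Equiv.Perm (Fin 3)))) := by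
      refine ⟨fun ⟨d, hd⟩ => h (Units.ext ?_)⟩
      rw [mem_fixedBy_iff] at hd
      obtain ⟨a, ha⟩ := d.2.2
      have h2 : ∑ k, a k * (u * d.1 k) = 1 := by
        rw [← ha]
        exact sum_congr rfl fun k _ => by rw [← hd k]; rfl
      calc (u : ZMod v) = u * ∑ k, a k * d.1 k := by rw [ha, mul_one]
        _ = ∑ k, a k * (u * d.1 k) := by
          rw [mul_sum]; exact sum_congr rfl fun k _ => by ring
        _ = _ := by rw [h2]; rfl
    exact Nat.card_of_isEmpty

variable [NeZero v]

/-- Being fixed gives `d j = u * d i` and `d i = u * d j`, with `d i` a unit. Conversely, if `u ^ 2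
= 1`, the condition on the third side `-(1 + u) * d i` is automatic. -/
theorem fixedCount_transposition {σ : Equiv.Perm (Fin 3)} {i j k : Fin 3} (hij : i ≠ j)
    (hjk : j ≠ k) (hik : i ≠ k) (hi : σ i = j) (hj : σ j = i) (hk : σ k = k) (u : (ZMod v)ˣ) :
    fixedCount v u σ = if (u : ZMod v) ^ 2 = 1 then v.totient else 0 := by
  unfold fixedCount
  have key : ∀ d, d ∈ MulAction.fixedBy (UnimodularTriple v) (u, σ) ↔
      (u : ZMod v) ^ 2 = 1 ∧ d.1 j = u * d.1 i := by
    intro d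
    rw [mem_fixedBy_iff]
    constructor
    · intro h
      have h1 := h i
      have h2 := h j
      rw [hi] at h1
      rw [hj] at h2
      refine ⟨?_, h1⟩
      obtain ⟨-, hu⟩ := d.isUnit_of_eq_mul hij.symm hik hjk h1
      apply hu.mul_right_cancel
      rw [one_mul]
      linear_combination -h2 - u * h1
    · rintro ⟨hu, h⟩
      obtain ⟨h1, -⟩ := d.isUnit_of_eq_mul hij.symm hik hjk h
      refine fin_three_forall hij hjk hik ?_ ?_ ?_
      · rw [hi, h]
      · rw [hj, h]; linear_combination -d.1 i * hu
      · rw [hk, h1]; linear_combination d.1 i * hu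
  split_ifs with hu
  · rw [← natCard_ratio hij hjk hik (u : ZMod v)]
    exact Nat.card_congr (Equiv.subtypeEquivRight fun d => by rw [key]; simp [hu])
  · have : IsEmpty (MulAction.fixedBy (UnimodularTriple v) (u, σ)) :=
      ⟨fun ⟨d, hd⟩ => hu ((key d).1 hd).1⟩
    exact Nat.card_of_isEmpty

/-- A fixed triple is `x, u * x, u ^ 2 * x` with `x` a unit, and its sum must vanish. -/
theorem fixedCount_threeCycle {σ : Equiv.Perm (Fin 3)} {i j k : Fin 3} (hij : i ≠ j)
    (hjk : j ≠ k) (hik : i ≠ k) (hi : σ i = j) (hj : σ j = k) (hk : σ k = i) (u : (ZMod v)ˣ) :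
    fixedCount v u σ = if (u : ZMod v) ^ 2 + u + 1 = 0 then v.totient else 0 := by
  unfold fixedCount
  have key : ∀ d, d ∈ MulAction.fixedBy (UnimodularTriple v) (u, σ) ↔
      (u : ZMod v) ^ 2 + u + 1 = 0 ∧ d.1 j = u * d.1 i := by
    intro d
    rw [mem_fixedBy_iff]
    constructor
    · intro h
      have h1 := h i
      have h2 := h j
      rw [hi] at h1
      rw [hj] at h2
      refine ⟨?_, h1⟩
      obtain ⟨h3, hu⟩ := d.isUnit_of_eq_mul hij.symm hik hjk h1
      apply hu.mul_right_cancel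
      rw [zero_mul]
      linear_combination h3 - h2 - u * h1
    · rintro ⟨hu, h⟩
      obtain ⟨h1, -⟩ := d.isUnit_of_eq_mul hij.symm hik hjk h
      refine fin_three_forall hij hjk hik ?_ ?_ ?_
      · rw [hi, h]
      · rw [hj, h1, h]; linear_combination -d.1 i * hu
      · rw [hk, h1]; linear_combination d.1 i * hu
  split_ifs with hu
  · rw [← natCard_ratio hij hjk hik (u : ZMod v)]
    exact Nat.card_congr (Equiv.subtypeEquivRight fun d => by rw [key]; simp [hu])
  · have : IsEmpty (MulAction.fixedBy (UnimodularTriple v) (u, σ)) :=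
      ⟨fun ⟨d, hd⟩ => hu ((key d).1 hd).1⟩
    exact Nat.card_of_isEmpty

theorem sum_fixedCount {P : ZMod v → Prop} [DecidablePred P] (hP : ∀ x, P x → IsUnit x) :
    ∑ u : (ZMod v)ˣ, (if P u then v.totient else 0) = v.totient * Nat.card {x : ZMod v // P x} := by
  rw [← sum_filter, sum_const, smul_eq_mul, mul_comm, ← Fintype.card_subtype,
    ← Nat.card_eq_fintype_card]
  congr 1
  refine Nat.card_congr (Equiv.ofBijective (fun u => ⟨u.1, u.2⟩) ⟨fun u w h => ?_, fun x => ?_⟩)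
  · exact Subtype.ext (Units.ext (congrArg Subtype.val h))
  · obtain ⟨u, hu⟩ := hP x.1 x.2
    exact ⟨⟨u, hu ▸ x.2⟩, Subtype.ext hu⟩

theorem perm_fin_three_univ : (univ : Finset (Equiv.Perm (Fin 3))) =
    {1, Equiv.swap 0 1, Equiv.swap 0 2, Equiv.swap 1 2, finRotate 3, (finRotate 3)⁻¹} := by decide

theorem card_orbit_mul : Nat.card (Orbit v) * (v.totient * 6) =
    Nat.card (UnimodularTriple v) + 3 * (v.totient * Nat.card {x : ZMod v // x ^ 2 = 1}) +
      2 * (v.totient * Nat.card {x : ZMod v // x ^ 2 + x + 1 = 0}) := by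
  classical
  have := Fintype.ofFinite (UnimodularTriple v)
  have hb := MulAction.sum_card_fixedBy_eq_card_orbits_mul_card_group
    ((ZMod v)ˣ × Equiv.Perm (Fin 3)) (UnimodularTriple v)
  rw [Fintype.card_prod, ZMod.card_units_eq_totient, Fintype.card_perm, Fintype.card_fin,
    Fintype.sum_prod_type_right] at hb
  simp only [← Nat.card_eq_fintype_card] at hb
  rw [show Nat.factorial 3 = 6 from rfl] at hb
  refine hb.symm.trans ?_
  change ∑ σ, ∑ u, fixedCount v u σ = _
  have h1 : ∑ u, fixedCount v u 1 = Nat.card (UnimodularTriple v) := by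
    simp [fixedCount_one]
  have h2 : ∀ {σ : Equiv.Perm (Fin 3)} {i j k : Fin 3}, i ≠ j → j ≠ k → i ≠ k → σ i = j → σ j = i →
      σ k = k → ∑ u, fixedCount v u σ = v.totient * Nat.card {x : ZMod v // x ^ 2 = 1} := by
    intro σ i j k hij hjk hik hi hj hk
    simp only [fixedCount_transposition hij hjk hik hi hj hk]
    exact sum_fixedCount (P := fun x : ZMod v => x ^ 2 = 1) fun x hx => IsUnit.of_mul_eq_one x (by rw [← sq, hx])
  have h3 : ∀ {σ : Equiv.Perm (Fin 3)} {i j k : Fin 3}, i ≠ j → j ≠ k → i ≠ k → σ i = j → σ j = k →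
      σ k = i → ∑ u, fixedCount v u σ =
        v.totient * Nat.card {x : ZMod v // x ^ 2 + x + 1 = 0} := by
    intro σ i j k hij hjk hik hi hj hk
    simp only [fixedCount_threeCycle hij hjk hik hi hj hk]
    exact sum_fixedCount (P := fun x : ZMod v => x ^ 2 + x + 1 = 0)
      fun x hx => IsUnit.of_mul_eq_one (-x - 1) (by linear_combination -hx)
  rw [perm_fin_three_univ, sum_insert (by decide), sum_insert (by decide), sum_insert (by decide),
    sum_insert (by decide), sum_insert (by decide), sum_singleton, h1,
    h2 (i := 0) (j := 1) (k := 2) (by decide) (by decide) (by decide) (by decide) (by decide) (by decide),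
    h2 (i := 0) (j := 2) (k := 1) (by decide) (by decide) (by decide) (by decide) (by decide) (by decide),
    h2 (i := 1) (j := 2) (k := 0) (by decide) (by decide) (by decide) (by decide) (by decide) (by decide),
    h3 (i := 0) (j := 1) (k := 2) (by decide) (by decide) (by decide) (by decide) (by decide) (by decide),
    h3 (i := 0) (j := 2) (k := 1) (by decide) (by decide) (by decide) (by decide) (by decide) (by decide)]
  ring

end Burnside

/-! ### Multiplicative counts modulo `v` -/

section Counting

theorem natCard_subtype_of_equiv_prod {X Y Z : Type*} {P : X → Prop} {Q : Y → Prop} {R : Z → Prop}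
    (e : X ≃ Y × Z) (h : ∀ x, P x ↔ Q (e x).1 ∧ R (e x).2) :
    Nat.card {x // P x} = Nat.card {y // Q y} * Nat.card {z // R z} := by
  rw [← Nat.card_prod]
  exact Nat.card_congr ((e.subtypeEquiv h).trans Equiv.subtypeProdEquivProd)

/-- The number of square roots of one modulo `n`. -/
noncomputable def sqrtOneCount (n : ℕ) : ℕ := Nat.card {x : ZMod n // x ^ 2 = 1}

/-- The number of roots of `X ^ 2 + X + 1` modulo `n`. -/
noncomputable def cyclotomicCount (n : ℕ) : ℕ := Nat.card {x : ZMod n // x ^ 2 + x + 1 = 0}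

/-- The number of pairs generating the unit ideal modulo `n`. -/
noncomputable def coprimePairCount (n : ℕ) : ℕ :=
  Nat.card {q : ZMod n × ZMod n // IsCoprime q.1 q.2}

theorem sqrtOneCount_mul {m n : ℕ} (h : m.Coprime n) :
    sqrtOneCount (m * n) = sqrtOneCount m * sqrtOneCount n :=
  natCard_subtype_of_equiv_prod (ZMod.chineseRemainder h).toEquiv fun x => by
    rw [← (ZMod.chineseRemainder h).injective.eq_iff, map_pow, map_one, Prod.ext_iff]
    rfl

theorem cyclotomicCount_mul {m n : ℕ} (h : m.Coprime n) :
    cyclotomicCount (m * n) = cyclotomicCount m * cyclotomicCount n :=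
  natCard_subtype_of_equiv_prod (ZMod.chineseRemainder h).toEquiv fun x => by
    rw [← (ZMod.chineseRemainder h).injective.eq_iff, map_add, map_add, map_pow, map_one, map_zero,
      Prod.ext_iff]
    rfl

theorem isCoprime_prod_iff {R S : Type*} [CommSemiring R] [CommSemiring S] {x y : R × S} :
    IsCoprime x y ↔ IsCoprime x.1 y.1 ∧ IsCoprime x.2 y.2 := by
  constructor
  · rintro ⟨a, b, h⟩
    exact ⟨⟨a.1, b.1, congrArg Prod.fst h⟩, ⟨a.2, b.2, congrArg Prod.snd h⟩⟩
  · rintro ⟨⟨a, b, h⟩, c, d, h'⟩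
    exact ⟨(a, c), (b, d), Prod.ext h h'⟩

theorem coprimePairCount_mul {m n : ℕ} (h : m.Coprime n) :
    coprimePairCount (m * n) = coprimePairCount m * coprimePairCount n :=
  natCard_subtype_of_equiv_prod (((ZMod.chineseRemainder h).toEquiv.prodCongr
    (ZMod.chineseRemainder h).toEquiv).trans (Equiv.prodProdProdComm _ _ _ _)) fun q => by
    have : IsCoprime q.1 q.2 ↔
        IsCoprime (ZMod.chineseRemainder h q.1) (ZMod.chineseRemainder h q.2) := by
      refine ⟨fun hq => hq.map (ZMod.chineseRemainder h).toRingHom, fun hq => ?_⟩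
      have := hq.map (ZMod.chineseRemainder h).symm.toRingHom
      simpa using this
    rw [this, isCoprime_prod_iff]
    rfl

theorem natCard_unimodularTriple (v : ℕ) :
    Nat.card (UnimodularTriple v) = coprimePairCount v := by
  refine Nat.card_congr (Equiv.ofBijective (fun d => ⟨(d.1 0, d.1 1), ?_⟩)
    ⟨fun d e h => ?_, fun q => ?_⟩)
  · obtain ⟨d, hd, a, ha⟩ := d
    rw [Fin.sum_univ_three] at hd ha
    exact ⟨a 0 - a 2, a 1 - a 2, by linear_combination ha - a 2 * hd⟩
  · have h0 : d.1 0 = e.1 0 := congrArg (fun q => q.1.1) h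
    have h1 : d.1 1 = e.1 1 := congrArg (fun q => q.1.2) h
    refine Subtype.ext (funext (fin_three_forall (i := 0) (j := 1) (k := 2) (by decide) (by decide)
      (by decide) h0 h1 ?_))
    have hd := d.2.1
    have he := e.2.1
    rw [Fin.sum_univ_three] at hd he
    linear_combination hd - he - h0 - h1
  · obtain ⟨⟨x, y⟩, a, b, h⟩ := q
    refine ⟨⟨![x, y, -x - y], by simp [Fin.sum_univ_three], ![a, b, 0], ?_⟩, rfl⟩
    simpa [Fin.sum_univ_three] using h

/-! ### Evaluation at prime powers, where `ZMod (p ^ (n + 1))` is local -/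

section PrimePower

variable {p n : ℕ} [hp : Fact p.Prime]

theorem isUnit_primePow_iff {x : ZMod (p ^ (n + 1))} :
    IsUnit x ↔ ZMod.castHom (dvd_pow_self p n.succ_ne_zero) (ZMod p) x ≠ 0 := by
  have hx : ((x.val : ℕ) : ZMod (p ^ (n + 1))) = x := ZMod.natCast_zmod_val x
  rw [← hx, map_natCast, ZMod.isUnit_iff_coprime, Ne, ZMod.natCast_eq_zero_iff,
    Nat.coprime_pow_right_iff n.succ_pos, Nat.coprime_comm, hp.out.coprime_iff_not_dvd]

theorem isUnit_or_isUnit_of_isUnit_add {x y : ZMod (p ^ (n + 1))} (h : IsUnit (x + y)) :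
    IsUnit x ∨ IsUnit y := by
  rw [isUnit_primePow_iff] at h ⊢
  rw [isUnit_primePow_iff]
  by_contra! hc
  exact h (by rw [map_add, hc.1, hc.2, add_zero])

theorem isUnit_natCast_primePow {a : ℕ} (ha : ¬ p ∣ a) : IsUnit (a : ZMod (p ^ (n + 1))) := by
  rw [ZMod.isUnit_iff_coprime]
  exact Nat.Coprime.pow_right _ ((hp.out.coprime_iff_not_dvd.2 ha).symm)

theorem isCoprime_primePow_iff {x y : ZMod (p ^ (n + 1))} :
    IsCoprime x y ↔ IsUnit x ∨ IsUnit y := by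
  constructor
  · rintro ⟨a, b, h⟩
    rcases isUnit_or_isUnit_of_isUnit_add (h ▸ isUnit_one) with h | h
    · exact Or.inl (isUnit_of_mul_isUnit_right h)
    · exact Or.inr (isUnit_of_mul_isUnit_right h)
  · rintro (⟨u, rfl⟩ | ⟨u, rfl⟩)
    · exact ⟨↑u⁻¹, 0, by simp⟩
    · exact ⟨0, ↑u⁻¹, by simp⟩

theorem natCard_nonunits_primePow :
    Nat.card {x : ZMod (p ^ (n + 1)) // ¬ IsUnit x} = p ^ n := by
  classical
  have h1 : Fintype.card {x : ZMod (p ^ (n + 1)) // IsUnit x} = (p ^ (n + 1)).totient := by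
    rw [← ZMod.card_units_eq_totient]
    exact Fintype.card_congr (Equiv.ofBijective (fun x => x.2.unit)
      ⟨fun x y h => Subtype.ext (congrArg Units.val h), fun u => ⟨⟨u, u.isUnit⟩, Units.ext rfl⟩⟩)
  rw [Nat.card_eq_fintype_card, Fintype.card_subtype_compl, h1, ZMod.card,
    Nat.totient_prime_pow hp.out n.succ_pos, Nat.succ_sub_one, pow_succ,
    ← Nat.mul_sub, Nat.sub_sub_self hp.out.one_le, mul_one]

/-- In a local ring a pair fails to generate the unit ideal exactly when both entries are nonunits.
-/
theorem coprimePairCount_primePow :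
    coprimePairCount (p ^ (n + 1)) + p ^ n * p ^ n = p ^ (n + 1) * p ^ (n + 1) := by
  classical
  have h1 : Nat.card {q : ZMod (p ^ (n + 1)) × ZMod (p ^ (n + 1)) // ¬ IsCoprime q.1 q.2} =
      p ^ n * p ^ n := by
    rw [← natCard_nonunits_primePow (p := p) (n := n), ← Nat.card_prod]
    refine Nat.card_congr ((Equiv.subtypeEquivRight fun q => ?_).trans Equiv.subtypeProdEquivProd)
    rw [isCoprime_primePow_iff, not_or]
  unfold coprimePairCount
  rw [← h1, Nat.card_eq_fintype_card, Nat.card_eq_fintype_card, Fintype.card_subtype_compl,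
    Nat.add_sub_cancel' (Fintype.card_subtype_le _), Fintype.card_prod, ZMod.card]

theorem coprimePairCount_primePow_eq :
    (coprimePairCount (p ^ (n + 1)) : ℚ) =
      (p ^ (n + 1)).totient * ((p ^ (n + 1) : ℕ) : ℚ) * (1 + 1 / (p : ℚ)) := by
  have h := coprimePairCount_primePow (p := p) (n := n)
  rw [Nat.totient_prime_pow hp.out n.succ_pos, Nat.succ_sub_one]
  have hp0 : (p : ℚ) ≠ 0 := Nat.cast_ne_zero.2 hp.out.ne_zero
  have h' := congrArg (Nat.cast : ℕ → ℚ) h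
  push_cast [Nat.cast_sub hp.out.one_le] at h' ⊢
  field_simp
  linear_combination p * h'

theorem natCard_eq_two_of_roots {R : Type*} [CommRing R] {P : R → Prop} {a b : R} (hab : a ≠ b)
    (h : ∀ x, P x ↔ x = a ∨ x = b) : Nat.card {x // P x} = 2 := by
  have : Nat.card {x // P x} = ({a, b} : Set R).ncard := by
    rw [← Nat.card_coe_set_eq]
    exact Nat.card_congr (Equiv.subtypeEquivRight fun x => by rw [h]; rfl)
  rw [this, Set.ncard_pair hab]

/-- In `ZMod (p ^ (n + 1))` a monic quadratic with unit root difference has exactly two roots. -/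
theorem eq_or_eq_of_mul_eq_zero {a b x : ZMod (p ^ (n + 1))} (hab : IsUnit (b - a))
    (h : (x - a) * (x - b) = 0) : x = a ∨ x = b := by
  have : IsUnit ((x - a) + -(x - b)) := by convert hab using 1; ring
  rcases isUnit_or_isUnit_of_isUnit_add this with hu | hu
  · exact Or.inr (sub_eq_zero.1 (hu.mul_right_eq_zero.1 h))
  · rw [IsUnit.neg_iff] at hu
    exact Or.inl (sub_eq_zero.1 (hu.mul_left_eq_zero.1 h))

theorem nontrivial_primePow : Nontrivial (ZMod (p ^ (n + 1))) :=
  ZMod.nontrivial_iff.2 (Nat.one_lt_pow n.succ_ne_zero hp.out.one_lt).ne'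

theorem sqrtOneCount_primePow (hp2 : p ≠ 2) : sqrtOneCount (p ^ (n + 1)) = 2 := by
  have := nontrivial_primePow (p := p) (n := n)
  have h2 : IsUnit (-1 - 1 : ZMod (p ^ (n + 1))) := by
    have := isUnit_natCast_primePow (p := p) (n := n) (a := 2) fun h =>
      hp2 ((Nat.prime_dvd_prime_iff_eq hp.out Nat.prime_two).1 h)
    convert this.neg using 1
    push_cast; ring
  refine natCard_eq_two_of_roots (a := 1) (b := -1) (fun h => h2.ne_zero (by linear_combination -h))
    fun x => ⟨fun hx => eq_or_eq_of_mul_eq_zero h2 (by linear_combination hx), ?_⟩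
  rintro (rfl | rfl) <;> ring

/-- As 3 divides `p - 1`, Cauchy's theorem gives a unit of order 3. It is a root, and `-1 - x` is
the other one. -/
theorem cyclotomicCount_primePow_one (h3 : p % 3 = 1) : cyclotomicCount (p ^ (n + 1)) = 2 := by
  have := nontrivial_primePow (p := p) (n := n)
  have hp1 := hp.out.one_lt
  have hu3 : IsUnit (3 : ZMod (p ^ (n + 1))) := by
    have h := isUnit_natCast_primePow (p := p) (n := n) (a := 3) fun h => by
      rw [(Nat.prime_dvd_prime_iff_eq hp.out Nat.prime_three).1 h] at h3
      omega
    exact_mod_cast h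
  have : Fact (Nat.Prime 3) := ⟨Nat.prime_three⟩
  obtain ⟨u, hu⟩ := exists_prime_orderOf_dvd_card (G := (ZMod (p ^ (n + 1)))ˣ) 3 (by
    rw [ZMod.card_units_eq_totient, Nat.totient_prime_pow hp.out n.succ_pos]
    exact Dvd.dvd.mul_left (by omega) _)
  have hu1 : u ≠ 1 := by
    rintro rfl
    rw [orderOf_one] at hu; omega
  have hu3' : (u : ZMod (p ^ (n + 1))) ^ 3 = 1 := by
    rw [← Units.val_pow_eq_pow_val, ← hu, pow_orderOf_eq_one, Units.val_one]
  obtain ⟨x, hx⟩ : ∃ x : ZMod (p ^ (n + 1)), x ^ 2 + x + 1 = 0 := by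
    refine ⟨u, ?_⟩
    have hprod : ((u : ZMod (p ^ (n + 1))) - 1) * ((u : ZMod (p ^ (n + 1))) ^ 2 + u + 1) = 0 := by
      linear_combination hu3'
    -- The sum equals the unit 3, so one of the two factors of `u ^ 3 - 1` is a unit and the other
    -- vanishes.
    have hsum : IsUnit (((u : ZMod (p ^ (n + 1))) ^ 2 + u + 1) +
        -(((u : ZMod (p ^ (n + 1))) - 1) * (u + 2))) := by
      convert hu3 using 1; ring
    rcases isUnit_or_isUnit_of_isUnit_add hsum with h | h
    · exact absurd (Units.ext (sub_eq_zero.1 (h.mul_left_eq_zero.1 hprod))) hu1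
    · rw [IsUnit.neg_iff] at h
      exact (isUnit_of_mul_isUnit_left h).mul_right_eq_zero.1 hprod
  have hd : IsUnit ((-1 - x) - x) := by
    -- The square of the root difference is the discriminant `-3`.
    refine isUnit_of_mul_isUnit_left (y := (-1 - x) - x) ?_
    convert hu3.neg using 1
    linear_combination 4 * hx
  refine natCard_eq_two_of_roots (a := x) (b := -1 - x)
    (fun h => hd.ne_zero (by linear_combination -h))
    fun y => ⟨fun hy => eq_or_eq_of_mul_eq_zero hd (by linear_combination hy - hx), ?_⟩
  rintro (rfl | rfl)
  · exact hx
  · linear_combination hx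

theorem cyclotomicCount_eq_zero_of_castHom {m n : ℕ} (h : m ∣ n)
    (hm : ∀ x : ZMod m, x ^ 2 + x + 1 ≠ 0) : cyclotomicCount n = 0 := by
  have : IsEmpty {x : ZMod n // x ^ 2 + x + 1 = 0} := by
    refine ⟨fun ⟨x, hx⟩ => hm (ZMod.castHom h (ZMod m) x) ?_⟩
    rw [← map_pow, ← map_add, ← map_one (ZMod.castHom h (ZMod m)), ← map_add, hx, map_zero]
  exact Nat.card_of_isEmpty

/-- A root modulo `p` satisfies `x ^ 3 = 1`; as `p - 1` is 1 modulo 3, Fermat gives `x = 1`, whence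
`p = 3`. -/
theorem cyclotomicCount_primePow_two (h3 : p % 3 = 2) : cyclotomicCount (p ^ (n + 1)) = 0 := by
  refine cyclotomicCount_eq_zero_of_castHom (dvd_pow_self p n.succ_ne_zero) fun x hx => ?_
  have hx3 : x ^ 3 = 1 := by linear_combination (x - 1) * hx
  have hx0 : x ≠ 0 := by
    rintro rfl
    simp at hx
  have h1 := ZMod.pow_card_sub_one_eq_one hx0
  have hx1 : x = 1 := by
    have : p - 1 = 3 * (p / 3) + 1 := by omega
    rwa [this, pow_succ, pow_mul, hx3, one_pow, one_mul] at h1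
  subst hx1
  have h30 : ((3 : ℕ) : ZMod p) = 0 := by push_cast; linear_combination hx
  rw [ZMod.natCast_eq_zero_iff, Nat.prime_dvd_prime_iff_eq hp.out Nat.prime_three] at h30
  omega

end PrimePower

theorem cyclotomicCount_three : cyclotomicCount (3 ^ 1) = 1 := by
  unfold cyclotomicCount
  rw [Nat.card_eq_fintype_card]
  decide

theorem cyclotomicCount_three_pow (n : ℕ) : cyclotomicCount (3 ^ (n + 2)) = 0 :=
  cyclotomicCount_eq_zero_of_castHom (m := 9) ⟨3 ^ n, by rw [pow_add, mul_comm]; norm_num⟩ (by decide)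

theorem sqrtOneCount_two : sqrtOneCount (2 ^ 1) = 1 := by
  unfold sqrtOneCount
  rw [Nat.card_eq_fintype_card]
  decide

theorem sqrtOneCount_four : sqrtOneCount (2 ^ 2) = 2 := by
  unfold sqrtOneCount
  rw [Nat.card_eq_fintype_card]
  decide

/-- The roots are `± 1` and `± 1 + h`, where `h` is half the modulus. -/
theorem sqrtOneCount_two_pow (m : ℕ) : sqrtOneCount (2 ^ (m + 3)) = 4 := by
  set h : ZMod (2 ^ (m + 3)) := 2 ^ (m + 2) with hh
  have hN : (2 : ZMod (2 ^ (m + 3))) ^ (m + 3) = 0 := by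
    have := ZMod.natCast_self (2 ^ (m + 3))
    push_cast at this
    exact this
  have h2 : 2 * h = 0 := by rw [hh, ← pow_succ', hN]
  have hsq : h * h = 0 := by
    calc h * h = 2 ^ (m + 3) * 2 ^ (m + 1) := by rw [hh]; ring
      _ = 0 := by rw [hN, zero_mul]
  have hN8 : 8 ≤ 2 ^ (m + 3) := by
    rw [pow_add]; have := Nat.one_le_two_pow (n := m); omega
  have h40 : (4 : ZMod (2 ^ (m + 3))) ≠ 0 := by
    exact_mod_cast natCast_ne_zero_of_lt (v := 2 ^ (m + 3)) (n := 4) (by norm_num) (by omega)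
  have hh0 : h ≠ 0 := by
    have := natCast_ne_zero_of_lt (v := 2 ^ (m + 3)) (n := 2 ^ (m + 2)) (by positivity)
      (Nat.pow_lt_pow_right (by norm_num) (by omega))
    push_cast at this
    exact this
  have hmul : ∀ c : ℕ, (c : ZMod (2 ^ (m + 3))) * h = 0 ∨ (c : ZMod (2 ^ (m + 3))) * h = h := by
    intro c
    rcases Nat.even_or_odd' c with ⟨d, rfl | rfl⟩
    · left; push_cast; linear_combination d * h2
    · right; push_cast; linear_combination d * h2
  have key : ∀ x : ZMod (2 ^ (m + 3)), x ^ 2 = 1 ↔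
      x ∈ ({1, -1, 1 + h, -1 + h} : Finset (ZMod (2 ^ (m + 3)))) := by
    intro x
    simp only [mem_insert, mem_singleton]
    constructor
    · intro hx
      have hxv : ((x.val : ℕ) : ZMod (2 ^ (m + 3))) = x := ZMod.natCast_zmod_val x
      have hdvd : ((2 ^ (m + 3) : ℕ) : ℤ) ∣ (x.val : ℤ) ^ 2 - 1 := by
        rw [← ZMod.intCast_zmod_eq_zero_iff_dvd _ _]
        push_cast
        rw [hxv, hx, sub_self]
      have hodd : Odd x.val := by
        rw [← Nat.not_even_iff_odd]
        rintro ⟨y, hy⟩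
        have h2d : (2 : ℤ) ∣ (x.val : ℤ) ^ 2 - 1 :=
          Dvd.dvd.trans ⟨2 ^ (m + 2), by push_cast; ring⟩ hdvd
        rw [hy] at h2d
        obtain ⟨z, hz⟩ := h2d
        push_cast at hz
        have : 2 * (2 * (y : ℤ) ^ 2 - z) = 1 := by linear_combination hz
        omega
      obtain ⟨y, hy⟩ := hodd
      -- With `x = 2y + 1`, `x ^ 2 - 1 = 4y(y + 1)`. Of two consecutive integers one is odd, so the
      -- power of two divides the other, and `x` is `± 1` plus a multiple of `h`.
      have hdy : 2 ^ (m + 1) ∣ y * (y + 1) := by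
        obtain ⟨c, hc⟩ := hdvd
        rw [hy] at hc
        push_cast at hc
        have : ((y * (y + 1) : ℕ) : ℤ) = ((2 ^ (m + 1) : ℕ) : ℤ) * c := by
          push_cast
          have e : (4 : ℤ) * (y * (y + 1)) = 4 * (2 ^ (m + 1) * c) := by
            linear_combination hc
          linarith
        exact_mod_cast Dvd.intro c this.symm
      rcases Nat.even_or_odd y with he | ho
      · have : (2 ^ (m + 1)).Coprime (y + 1) :=
          Nat.Coprime.pow_left _ (Nat.coprime_two_left.2 he.add_one)
        obtain ⟨c, hc⟩ := this.dvd_of_dvd_mul_right hdy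
        have hxe : x = 1 + c * h := by
          rw [← hxv, hy, hc, hh]; push_cast; ring
        rcases hmul c with e | e
        · left; rw [hxe, e, add_zero]
        · right; right; left; rw [hxe, e]
      · have : (2 ^ (m + 1)).Coprime y := Nat.Coprime.pow_left _ (Nat.coprime_two_left.2 ho)
        obtain ⟨c, hc⟩ := this.dvd_of_dvd_mul_left hdy
        have hxe : x = -1 + c * h := by
          have hc' := congrArg (Nat.cast : ℕ → ZMod (2 ^ (m + 3))) hc
          push_cast at hc'
          rw [← hxv, hy, hh]; push_cast; linear_combination 2 * hc'
        rcases hmul c with e | e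
        · right; left; rw [hxe, e, add_zero]
        · right; right; right; rw [hxe, e]
    · rintro (rfl | rfl | rfl | rfl)
      · ring
      · ring
      · linear_combination hsq + h2
      · linear_combination hsq - h2
  unfold sqrtOneCount
  rw [Nat.card_congr (Equiv.subtypeEquivRight key), Nat.card_eq_fintype_card, Fintype.card_coe,
    card_insert_of_notMem, card_insert_of_notMem, card_pair]
  · intro e; apply h40; linear_combination 2 * e
  · simp only [mem_insert, mem_singleton, not_or]
    exact ⟨fun e => h40 (by linear_combination -2 * e - h2), fun e => hh0 (by linear_combination -e)⟩
  · simp only [mem_insert, mem_singleton, not_or]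
    exact ⟨fun e => h40 (by linear_combination 2 * e), fun e => hh0 (by linear_combination -e),
      fun e => h40 (by linear_combination 2 * e + h2)⟩

theorem natCard_eq_one_of_subsingleton {P : ZMod 1 → Prop} (h : P 0) : Nat.card {x // P x} = 1 := by
  rw [Nat.card_eq_one_iff_unique]
  exact ⟨⟨fun x y => Subtype.ext (Subsingleton.elim _ _)⟩, ⟨⟨0, h⟩⟩⟩

theorem sqrtOneCount_eq_prod {v : ℕ} (hv : v ≠ 0) :
    sqrtOneCount v = ∏ p ∈ v.primeFactors, sqrtOneCount (p ^ v.factorization p) :=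
  Nat.multiplicative_factorization _ (fun _ _ => sqrtOneCount_mul)
    (natCard_eq_one_of_subsingleton (Subsingleton.elim _ _)) hv

theorem cyclotomicCount_eq_prod {v : ℕ} (hv : v ≠ 0) :
    cyclotomicCount v = ∏ p ∈ v.primeFactors, cyclotomicCount (p ^ v.factorization p) :=
  Nat.multiplicative_factorization _ (fun _ _ => cyclotomicCount_mul)
    (natCard_eq_one_of_subsingleton (Subsingleton.elim _ _)) hv

theorem coprimePairCount_eq_prod {v : ℕ} (hv : v ≠ 0) :
    coprimePairCount v = ∏ p ∈ v.primeFactors, coprimePairCount (p ^ v.factorization p) := by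
  refine Nat.multiplicative_factorization _ (fun _ _ => coprimePairCount_mul) ?_ hv
  unfold coprimePairCount
  rw [Nat.card_eq_one_iff_unique]
  exact ⟨⟨fun x y => Subtype.ext (Subsingleton.elim _ _)⟩, ⟨⟨(0, 0), 0, 0, Subsingleton.elim _ _⟩⟩⟩

theorem factorization_eq_succ {v p : ℕ} (hp : p ∈ v.primeFactors) :
    ∃ n, v.factorization p = n + 1 := by
  obtain ⟨h1, h2, h3⟩ := Nat.mem_primeFactors.1 hp
  exact Nat.exists_eq_succ_of_ne_zero (h1.factorization_pos_of_dvd h3 h2).ne'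

theorem coprimePairCount_eq {v : ℕ} (hv : v ≠ 0) : (coprimePairCount v : ℚ) =
    v.totient * (v * ∏ p ∈ v.primeFactors, (1 + 1 / (p : ℚ))) := by
  have h1 : v.totient = ∏ p ∈ v.primeFactors, (p ^ v.factorization p).totient :=
    Nat.multiplicative_factorization _ (fun _ _ => Nat.totient_mul) Nat.totient_one hv
  have h2 : v = ∏ p ∈ v.primeFactors, p ^ v.factorization p :=
    (Nat.prod_factorization_pow_eq_self hv).symm
  have h3 : (v : ℚ) = ∏ p ∈ v.primeFactors, ((p ^ v.factorization p : ℕ) : ℚ) := by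
    rw [← Nat.cast_prod, ← h2]
  rw [coprimePairCount_eq_prod hv, h1, h3, Nat.cast_prod, Nat.cast_prod, ← prod_mul_distrib,
    ← prod_mul_distrib]
  refine prod_congr rfl fun p hp => ?_
  have : Fact p.Prime := ⟨Nat.prime_of_mem_primeFactors hp⟩
  obtain ⟨n, hn⟩ := factorization_eq_succ hp
  rw [hn, coprimePairCount_primePow_eq, mul_assoc]

theorem sqrtOneCount_of_odd {v : ℕ} (hv : Odd v) : sqrtOneCount v = 2 ^ v.primeFactors.card := by
  rw [sqrtOneCount_eq_prod hv.pos.ne']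
  refine prod_eq_pow_card fun p hp => ?_
  have : Fact p.Prime := ⟨Nat.prime_of_mem_primeFactors hp⟩
  obtain ⟨n, hn⟩ := factorization_eq_succ hp
  rw [hn]
  refine sqrtOneCount_primePow ?_
  rintro rfl
  exact (Nat.not_even_iff_odd.2 hv) (even_iff_two_dvd.2 (Nat.dvd_of_mem_primeFactors hp))

/-- Each odd prime contributes a factor 2; the factor 2 on the left compensates for the prime 2
being counted in the exponent on the right. -/
theorem two_mul_sqrtOneCount_of_even {v : ℕ} (hv : Even v) (hv0 : v ≠ 0) :
    2 * sqrtOneCount v = sqrtOneCount (2 ^ v.factorization 2) * 2 ^ v.primeFactors.card := by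
  have h2 : 2 ∈ v.primeFactors := Nat.mem_primeFactors.2 ⟨Nat.prime_two, hv.two_dvd, hv0⟩
  rw [sqrtOneCount_eq_prod hv0, ← mul_prod_erase _ _ h2, prod_eq_pow_card (b := 2),
    ← card_erase_add_one h2, pow_succ]
  · ring
  · intro p hp
    obtain ⟨hp2, hp⟩ := mem_erase.1 hp
    have : Fact p.Prime := ⟨Nat.prime_of_mem_primeFactors hp⟩
    obtain ⟨n, hn⟩ := factorization_eq_succ hp
    rw [hn, sqrtOneCount_primePow hp2]

theorem sqrtOneCount_two_part {v : ℕ} (hv : Even v) (hv0 : v ≠ 0) :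
    (sqrtOneCount (2 ^ v.factorization 2) : ℚ) = 4 * betaCoeff v := by
  have hd : ∀ k, 2 ^ k ∣ v ↔ k ≤ v.factorization 2 := fun k =>
    Nat.prime_two.pow_dvd_iff_le_factorization hv0
  have h1 := hd 1
  have h2 := hd 2
  have h3 := hd 3
  have hv2 := hv.two_dvd
  norm_num at h1 h2 h3
  unfold betaCoeff
  split_ifs with c1 c2
  · have : v.factorization 2 = 1 := by omega
    rw [this, sqrtOneCount_two]; norm_num
  · have : v.factorization 2 = 2 := by omega
    rw [this, sqrtOneCount_four]; norm_num
  · obtain ⟨m, hm⟩ : ∃ m, v.factorization 2 = m + 3 := ⟨v.factorization 2 - 3, by omega⟩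
    rw [hm, sqrtOneCount_two_pow]; norm_num

theorem cyclotomicCount_of_even {v : ℕ} (hv : Even v) : cyclotomicCount v = 0 :=
  cyclotomicCount_eq_zero_of_castHom hv.two_dvd (by decide)

/-- The coefficient is 1, 1/2 or 0 in the three cases of `alphaCoeff`: primes that are 1 modulo 3
contribute 2, an exact factor 3 contributes 1, and anything else contributes 0. -/
theorem cyclotomicCount_eq {v : ℕ} (hv : v ≠ 0) :
    (cyclotomicCount v : ℚ) = (3 * alphaCoeff v - 3 / 2) * 2 ^ v.primeFactors.card := by
  have hprod := cyclotomicCount_eq_prod hv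
  have hone : ∀ p ∈ v.primeFactors, p % 3 = 1 → cyclotomicCount (p ^ v.factorization p) = 2 := by
    intro p hp h
    have : Fact p.Prime := ⟨Nat.prime_of_mem_primeFactors hp⟩
    obtain ⟨n, hn⟩ := factorization_eq_succ hp
    rw [hn, cyclotomicCount_primePow_one h]
  have hthree : ∀ p ∈ v.primeFactors, p % 3 = 0 → p = 3 := fun p hp h =>
    ((Nat.prime_dvd_prime_iff_eq Nat.prime_three (Nat.prime_of_mem_primeFactors hp)).1
      (Nat.dvd_of_mod_eq_zero h)).symm
  unfold alphaCoeff
  split_ifs with c1 c2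
  · rw [hprod, prod_eq_pow_card (b := 2) fun p hp => hone p hp (c1 p hp)]
    push_cast; ring
  · obtain ⟨c2, c3⟩ := c2
    have h3 : 3 ∈ v.primeFactors := by
      rw [← Nat.support_factorization, Finsupp.mem_support_iff, c2]; norm_num
    rw [hprod, ← mul_prod_erase _ _ h3, c2, cyclotomicCount_three, prod_eq_pow_card (b := 2),
      ← card_erase_add_one h3, pow_succ]
    · push_cast; ring
    · intro p hp
      obtain ⟨hp3, hp⟩ := mem_erase.1 hp
      exact hone p hp (c3 p hp hp3)
  · have hzero : ∃ p ∈ v.primeFactors, cyclotomicCount (p ^ v.factorization p) = 0 := by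
      by_cases h2 : ∃ p ∈ v.primeFactors, p % 3 = 2
      · obtain ⟨p, hp, h2⟩ := h2
        have : Fact p.Prime := ⟨Nat.prime_of_mem_primeFactors hp⟩
        obtain ⟨n, hn⟩ := factorization_eq_succ hp
        exact ⟨p, hp, by rw [hn, cyclotomicCount_primePow_two h2]⟩
      · push Not at h2 c1
        obtain ⟨p, hp, hp1⟩ := c1
        have hp2 := h2 p hp
        obtain rfl := hthree p hp (by omega)
        refine ⟨3, hp, ?_⟩
        obtain ⟨n, hn⟩ := factorization_eq_succ hp
        rcases n with - | n
        · refine absurd ⟨hn, fun q hq hq3 => ?_⟩ c2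
          have := h2 q hq
          have := mt (hthree q hq) hq3
          omega
        · rw [hn, cyclotomicCount_three_pow]
    obtain ⟨p, hp, h0⟩ := hzero
    rw [hprod, prod_eq_zero hp h0]
    norm_num

end Counting

/-- Burnside's identity divided by the group order `6 * v.totient`; the totient cancels from every
term. -/
theorem natCard_orbit {v : ℕ} (hv : v ≠ 0) : (Nat.card (Orbit v) : ℚ) =
    (v : ℚ) / 6 * ∏ p ∈ v.primeFactors, (1 + 1 / (p : ℚ)) + (sqrtOneCount v : ℚ) / 2 +
      (cyclotomicCount v : ℚ) / 3 := by
  have : NeZero v := ⟨hv⟩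
  have h := congrArg (Nat.cast : ℕ → ℚ) (card_orbit_mul (v := v))
  have hφ : (v.totient : ℚ) ≠ 0 :=
    Nat.cast_ne_zero.2 (Nat.totient_pos.2 (Nat.pos_of_ne_zero hv)).ne'
  rw [natCard_unimodularTriple] at h
  push_cast at h
  rw [coprimePairCount_eq hv] at h
  change _ = _ + 3 * ((v.totient : ℚ) * (sqrtOneCount v : ℚ)) +
    2 * ((v.totient : ℚ) * (cyclotomicCount v : ℚ)) at h
  apply mul_left_cancel₀ hφ
  linear_combination h / 6

end CyclicConfiguration

open CyclicConfiguration in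
theorem theoremA (v : ℕ) (hv : 4 < v) :
    (Odd v → (numConnectedCyclic v 3 : ℚ) =
      (v : ℚ) / 6 * ∏ p ∈ v.primeFactors, (1 + 1 / (p : ℚ))
        + alphaCoeff v * 2 ^ v.primeFactors.card - 2) ∧
    (Even v → (numConnectedCyclic v 3 : ℚ) =
      (v : ℚ) / 6 * ∏ p ∈ v.primeFactors, (1 + 1 / (p : ℚ))
        + betaCoeff v * 2 ^ v.primeFactors.card - 3) := by
  have hv0 : v ≠ 0 := by omega
  have : NeZero v := ⟨hv0⟩
  have hadd := numConnectedCyclic_add_ncard hv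
  have horb := natCard_orbit hv0
  rw [← hadd] at horb
  constructor
  · intro ho
    rw [ncard_degenerate_of_odd hv ho, sqrtOneCount_of_odd ho, cyclotomicCount_eq hv0] at horb
    push_cast at horb
    linear_combination horb
  · intro he
    rw [ncard_degenerate_of_even hv he, cyclotomicCount_of_even he] at horb
    -- There are no roots of `X ^ 2 + X + 1` for even `v`, so the `betaCoeff` term is half the
    -- number of square roots of one.
    have h2 := congrArg (Nat.cast : ℕ → ℚ) (two_mul_sqrtOneCount_of_even he hv0)
    push_cast at horb h2
    rw [sqrtOneCount_two_part he hv0] at h2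
    linear_combination horb + h2 / 4
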